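/- Repeated bilateral trade with two-bit feedback, against a $\sigma$-smooth adversary. Let $\mathcal U=\{(p,q)\in[0,1]^2 : p\le q\}$. In each round $t=1,\dots,T$ the adversary privately chooses a $\sigma$-smooth probability distribution on $[0,1]^2$, i.e. a distribution $\mu$ with $\mu(A)\le \lambda(A)/\sigma$ for every measurable $A\subseteq[0,1]^2$, where $\lambda$ is the uniform distribution on $[0,1]^2$; the choice may depend on the valuations and on the internal randomization of the learner in the previous rounds. The valuations $(S_t,B_t)$ of the seller and of the buyer are drawn from it. The learner, who does not see them, posts a pair of prices $(P_t,Q_t)\in\mathcal U$, which may depend on its own randomization and on the feedback of the previous rounds, and then receives the two-bit feedback $(\mathbb I\{S_t\le P_t\},\mathbb I\{Q_t\le B_t\})$. The gain from trade is $\mathrm{GFT}_t(p,q)=\big((B_t-q)+(p-S_t)\big)\,\mathbb I\{S_t\le p\le q\le B_t\}$. The regret of an algorithm $\mathcal A$ against an adversary $\mathcal S$ is $$R_T(\mathcal A,\mathcal S)=\max_{(p,q)\in\mathcal U}\mathbb E\Big[\sum_{t=1}^T\mathrm{GFT}_t(p,q)-\sum_{t=1}^T\mathrm{GFT}_t(P_t,Q_t)\Big],$$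 and $R_T(\mathcal A)$ is the supremum of $R_T(\mathcal A,\mathcal S)$ over all $\sigma$-smooth adversaries $\mathcal S$. Theorem. Let $0<\sigma\le\frac19$ and $T\ge 8008$. Every (possibly randomized) learning algorithm $\mathcal A$ that posts two prices per round and receives two-bit feedback satisfies $$R_T(\mathcal A)\ \ge\ \frac1{50^3}\,T^{3/4}.$$ Moreover, the bound is already forced by i.i.d. adversaries: for every such $\mathcal A$ there is a $\sigma$-smooth probability distribution $\mu$ on $[0,1]^2$ such that the adversary $\mathcal S$ that draws $(S_1,B_1),(S_2,B_2),\dots$ i.i.d. from $\mu$, regardless of what the learner does, satisfies $R_T(\mathcal A,\mathcal S)\ge\frac1{50^3}\,T^{3/4}$. -/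

import Mathlib

open MeasureTheory ProbabilityTheory

namespace BilateralTrade

/-- A pair of valuations `(s, b) ∈ [0,1]²` of the seller and of the buyer. -/
abbrev Valuations : Type := unitInterval × unitInterval

/-- The upper triangle `{(p, q) ∈ [0,1]² | p ≤ q}`: `p` is posted to the seller, `q` to the
buyer. -/
abbrev Prices : Type := {x : unitInterval × unitInterval // x.1 ≤ x.2}

open Classical in
/-- The gain from trade `((b - q) + (p - s)) · 𝕀{s ≤ p ≤ q ≤ b}`. -/
noncomputable def GFT (x : Prices) (v : Valuations) : ℝ :=
  if v.1 ≤ x.1.1 ∧ x.1.1 ≤ x.1.2 ∧ x.1.2 ≤ v.2 then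
    ((v.2 : ℝ) - (x.1.2 : ℝ)) + ((x.1.1 : ℝ) - (v.1 : ℝ))
  else 0

open Classical in
/-- The two-bit feedback `(𝕀{s ≤ p}, 𝕀{q ≤ b})`. -/
noncomputable def twoBit (x : Prices) (v : Valuations) : Bool × Bool :=
  (decide (v.1 ≤ x.1.1), decide (x.1.2 ≤ v.2))

/-- A measure on `[0,1]²` is `σ`-smooth if `μ(A) ≤ ν(A) / σ` for all measurable `A`, where `ν`
is the uniform distribution on `[0,1]²`. -/
def IsSmooth (σ : ℝ) (μ : Measure Valuations) : Prop :=
  ∀ A : Set Valuations, MeasurableSet A → μ A ≤ volume A / ENNReal.ofReal σ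

/-- A randomized learning algorithm that posts two prices per round on the basis of two-bit
feedback. In each round it draws a fresh random seed in an arbitrary probability space
`(Θ, seedLaw)`. Rounds are numbered `0, 1, 2, …`; the prices of round `t` are a measurable
function of the seeds of the rounds `0, …, t` and of the feedback of the rounds `0, …, t - 1`. -/
structure Algorithm (Θ : Type*) [MeasurableSpace Θ] where
  /-- The law of the seed of a round. -/
  seedLaw : Measure Θ
  isProbabilityMeasure_seedLaw : IsProbabilityMeasure seedLaw
  /-- The prices of round `t`, given the seeds so far and the past feedback. -/
  price : (t : ℕ) → (Fin (t + 1) → Θ) → (Fin t → Bool × Bool) → Prices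
  measurable_price : ∀ t, Measurable fun h : (Fin (t + 1) → Θ) × (Fin t → Bool × Bool) =>
    price t h.1 h.2

/-- An adaptive `σ`-smooth adversary: the distribution of the valuations of round `t` may depend
on the valuations and on the internal randomization of the algorithm in the rounds before `t`, and
is always a `σ`-smooth probability measure on `[0,1]²`. -/
structure Adversary (Θ : Type*) [MeasurableSpace Θ] (σ : ℝ) where
  /-- The distribution of the valuations of round `t`, given the past. -/
  choice : (t : ℕ) → Kernel (Fin t → Θ × Valuations) Valuations
  isMarkovKernel_choice : ∀ t, IsMarkovKernel (choice t)
  smooth : ∀ t h, IsSmooth σ (choice t h)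

/-- The i.i.d. adversary: in every round the valuations are drawn from the same distribution `μ`,
independently of the past. -/
noncomputable def Adversary.iid {Θ : Type*} [MeasurableSpace Θ] {σ : ℝ} (μ : Measure Valuations)
    (hμ : IsProbabilityMeasure μ) (hs : IsSmooth σ μ) : Adversary Θ σ where
  choice _ := Kernel.const _ μ
  isMarkovKernel_choice _ := inferInstance
  smooth _ h := by simpa using hs

section Protocol

variable {Θ : Type*} [MeasurableSpace Θ]

/-- The feedback received in the rounds `0, …, t - 1`, as a function of the seeds and of the
valuations of these rounds. -/
noncomputable def Algorithm.feedback (A : Algorithm Θ) :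
    (t : ℕ) → (Fin t → Θ × Valuations) → (Fin t → Bool × Bool)
  | 0, _ => Fin.elim0
  | t + 1, h =>
    let z : Fin t → Bool × Bool := A.feedback t (fun i => h i.castSucc)
    Fin.snoc (α := fun _ => Bool × Bool) z
      (twoBit (A.price t (fun i => (h i).1) z) (h (Fin.last t)).2)

/-- The prices posted in round `t < T`, as a function of the seeds and of the valuations of the
rounds `0, …, T - 1`; only the seeds up to round `t` and the feedback before round `t` matter. -/
noncomputable def Algorithm.posted (A : Algorithm Θ) {T : ℕ} (h : Fin T → Θ × Valuations)
    (t : Fin T) : Prices :=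
  A.price t (fun i => (h (i.castLE t.isLt)).1)
    (A.feedback t (fun i => h (i.castLE t.isLt.le)))

/-- The joint law of the seeds and of the valuations of the first `T` rounds. Given the past, the
seed and the valuations of a round are independent, the seed with law `A.seedLaw` and the
valuations with the law chosen by the adversary. -/
noncomputable def jointLaw (A : Algorithm Θ) {σ : ℝ} (S : Adversary Θ σ) :
    (T : ℕ) → Measure (Fin T → Θ × Valuations)
  | 0 => Measure.dirac Fin.elim0
  | T + 1 =>
    (jointLaw A S T ⊗ₘ (Kernel.const _ A.seedLaw ×ₖ S.choice T)).map
      (fun x => Fin.snoc (α := fun _ => Θ × Valuations) x.1 x.2)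

/-- The regret of the algorithm `A` against the adversary `S` over `T` rounds:
`max_{(p,q)} 𝔼[∑ₜ GFTₜ(p,q) - ∑ₜ GFTₜ(Pₜ,Qₜ)]`. -/
noncomputable def regret (A : Algorithm Θ) {σ : ℝ} (S : Adversary Θ σ) (T : ℕ) : ℝ :=
  ⨆ x : Prices, ∫ h, ((∑ t : Fin T, GFT x (h t).2) - ∑ t : Fin T, GFT (A.posted h t) (h t).2)
    ∂(jointLaw A S T)

/-- The regret of the algorithm `A` over `T` rounds: the supremum of its regret over all
`σ`-smooth adversaries. -/
noncomputable def worstCaseRegret (A : Algorithm Θ) (σ : ℝ) (T : ℕ) : EReal :=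
  ⨆ S : Adversary Θ σ, (regret A S T : EReal)

end Protocol

end BilateralTrade

/-!
Around a base density, whose best single prices `p = q` fill a whole interval, cut part of this
interval into `K` strips of width `2 * d` with `d * K` constant, and perturb the density by a
wave of amplitude one over the `k`-th strip. This makes the midpoint of the strip better by order
`d` than every price outside the strip, but the feedback reveals the perturbation only to prices
`p < q` far apart, with `p` in the strip, each of which loses a constant. Such an informative round
contributes `O(d ^ 2)` to the Kullback–Leibler divergence, so that finding the right strip takes
order `d⁻²` informative rounds in each of the `K` strips. Hence the learner pays order
`K * d⁻² = K ^ 3` under the base density or order `T * d = T / K` under some perturbation, and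
both are `T ^ (3 / 4)` when `K` is about `T ^ (1 / 4)`.
-/

namespace BilateralTrade

open InformationTheory
open scoped ENNReal

section KullbackLeibler

variable {α β : Type*} [MeasurableSpace α] [MeasurableSpace β]

theorem klFun_le_sq {r : ℝ} (hr : 0 ≤ r) : klFun r ≤ (r - 1) ^ 2 := by
  rcases hr.eq_or_lt with rfl | hr
  · simp [klFun_zero]
  · rw [klFun_apply]
    nlinarith [mul_le_mul_of_nonneg_left (Real.log_le_sub_one_of_pos hr) hr.le]

theorem sq_div_two_le_klFun {r : ℝ} (hr₀ : 0 ≤ r) (hr₁ : r ≤ 1) : (1 - r) ^ 2 / 2 ≤ klFun r := by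
  have hanti : AntitoneOn (fun x => klFun x - (1 - x) ^ 2 / 2) (Set.Icc 0 1) := by
    refine antitoneOn_of_hasDerivWithinAt_nonpos (f' := fun x => Real.log x + (1 - x))
      (convex_Icc 0 1) (by fun_prop) (fun x hx => ?_) fun x hx => ?_
    · rw [interior_Icc] at hx
      have h := ((hasDerivAt_id x).const_sub 1).pow 2 |>.div_const 2
      exact ((hasDerivAt_klFun hx.1.ne').sub h).hasDerivWithinAt.congr_deriv (by simp; ring)
    · rw [interior_Icc] at hx
      linarith [Real.log_le_sub_one_of_pos hx.1]
  simpa [klFun_one] using hanti ⟨hr₀, hr₁⟩ ⟨zero_le_one, le_rfl⟩ hr₁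

theorem mul_one_sub_sub_sq_le_klFun {c r : ℝ} (hc : 0 ≤ c) (hr : 0 ≤ r) :
    2 * c * (1 - r) - c ^ 2 ≤ 2 * klFun r := by
  rcases le_total r 1 with hr₁ | hr₁
  · linarith [sq_div_two_le_klFun hr hr₁, sq_nonneg (c - (1 - r))]
  · linarith [klFun_nonneg hr, mul_nonneg hc (sub_nonneg.2 hr₁), sq_nonneg c]

variable {μ ν : Measure α}

theorem klDiv_le_sum_sq_div [Fintype α] [MeasurableSingletonClass α] [IsFiniteMeasure μ]
    [IsFiniteMeasure ν] (hν : ∀ z, 0 < ν.real {z}) :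
    klDiv μ ν ≤ ENNReal.ofReal (∑ z, (μ.real {z} - ν.real {z}) ^ 2 / ν.real {z}) := by
  have hν₀ : ∀ z, ν {z} ≠ 0 := fun z h => (hν z).ne' (by simp [Measure.real, h])
  have hac : μ ≪ ν := fun s hs => by
    rw [Set.eq_empty_of_forall_notMem fun z hz =>
      hν₀ z (measure_mono_null (Set.singleton_subset_iff.2 hz) hs), measure_empty]
  rw [klDiv_eq_lintegral_klFun_of_ac hac, lintegral_fintype,
    ENNReal.ofReal_sum_of_nonneg fun z _ => by have := hν z; positivity]
  refine Finset.sum_le_sum fun z _ => ?_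
  have hz : (μ.rnDeriv ν z).toReal * ν.real {z} = μ.real {z} := by
    rw [Measure.real, Measure.real, ← ENNReal.toReal_mul, ← lintegral_singleton,
      Measure.setLIntegral_rnDeriv hac]
  rw [← hz, ← ofReal_measureReal, ← ENNReal.ofReal_mul (klFun_nonneg ENNReal.toReal_nonneg)]
  refine ENNReal.ofReal_le_ofReal ?_
  calc _ ≤ ((μ.rnDeriv ν z).toReal - 1) ^ 2 * ν.real {z} :=
        mul_le_mul_of_nonneg_right (klFun_le_sq ENNReal.toReal_nonneg) measureReal_nonneg
    _ = _ := by have := (hν z).ne'; field_simp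

theorem measureReal_sub_le_sqrt_klDiv [IsProbabilityMeasure μ] [IsProbabilityMeasure ν]
    (h : klDiv μ ν ≠ ∞) (s : Set α) :
    ν.real s - μ.real s ≤ √(2 * (klDiv μ ν).toReal) := by
  have hac : μ ≪ ν := (klDiv_ne_top_iff.1 h).1
  have hkl : Integrable (fun x => klFun (μ.rnDeriv ν x).toReal) ν :=
    (integrable_klFun_rnDeriv_iff hac).2 (klDiv_ne_top_iff.1 h).2
  have hkl₀ : ∀ x, 0 ≤ klFun (μ.rnDeriv ν x).toReal := fun x => klFun_nonneg ENNReal.toReal_nonneg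
  set c := ν.real s - μ.real s with hc
  rcases le_total c 0 with hc₀ | hc₀
  · exact hc₀.trans (Real.sqrt_nonneg _)
  have hint : IntegrableOn (fun x => 1 - (μ.rnDeriv ν x).toReal) s ν :=
    ((integrable_const 1).sub Measure.integrable_toReal_rnDeriv).integrableOn
  have hset : ∫ x in s, (1 - (μ.rnDeriv ν x).toReal) ∂ν = c := by
    rw [integral_sub (integrable_const _) Measure.integrable_toReal_rnDeriv.integrableOn,
      Measure.setIntegral_toReal_rnDeriv hac]
    simp [hc]
  have hle : 2 * c * c - c ^ 2 * ν.real s ≤ 2 * (klDiv μ ν).toReal :=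
    calc 2 * c * c - c ^ 2 * ν.real s
        = ∫ x in s, (2 * c * (1 - (μ.rnDeriv ν x).toReal) - c ^ 2) ∂ν := by
          rw [integral_sub (hint.const_mul _) (integrable_const _), integral_const_mul, hset]
          simp [mul_comm]
      _ ≤ ∫ x in s, 2 * klFun (μ.rnDeriv ν x).toReal ∂ν :=
          integral_mono ((hint.const_mul _).sub (integrable_const _))
            (hkl.const_mul 2).integrableOn fun x =>
              mul_one_sub_sub_sq_le_klFun hc₀ ENNReal.toReal_nonneg
      _ ≤ ∫ x, 2 * klFun (μ.rnDeriv ν x).toReal ∂ν :=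
          setIntegral_le_integral (hkl.const_mul 2)
            (.of_forall fun x => mul_nonneg zero_le_two (hkl₀ x))
      _ = 2 * (klDiv μ ν).toReal := by
          rw [integral_const_mul, toReal_klDiv_eq_integral_klFun hac]
  refine Real.le_sqrt_of_sq_le ?_
  nlinarith [mul_le_mul_of_nonneg_left (measureReal_le_one (μ := ν) (s := s)) (sq_nonneg c)]

variable [MeasurableSpace.CountableOrCountablyGenerated α β] {κ η : Kernel α β}
  [IsFiniteKernel κ] [IsFiniteKernel η]

theorem klDiv_apply_eq_lintegral_rnDeriv (h : ∀ x, κ x ≪ η x) (x : α) :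
    klDiv (κ x) (η x) = ∫⁻ z, ENNReal.ofReal (klFun (κ.rnDeriv η x z).toReal) ∂(η x) := by
  rw [klDiv_eq_lintegral_klFun_of_ac (h x)]
  refine lintegral_congr_ae ?_
  filter_upwards [Kernel.rnDeriv_eq_rnDeriv_measure (κ := κ) (η := η) (a := x)] with z hz
  rw [hz]

theorem measurable_klDiv_kernel (h : ∀ x, κ x ≪ η x) : Measurable fun x => klDiv (κ x) (η x) := by
  simp only [klDiv_apply_eq_lintegral_rnDeriv h]
  exact ((measurable_klFun.comp
    (Kernel.measurable_rnDeriv κ η).ennreal_toReal).ennreal_ofReal).lintegral_kernel_prod_right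

theorem klDiv_compProd_eq_lintegral [IsFiniteMeasure μ] (h : ∀ x, κ x ≪ η x) :
    klDiv (μ ⊗ₘ κ) (μ ⊗ₘ η) = ∫⁻ x, klDiv (κ x) (η x) ∂μ := by
  have hm := Kernel.measurable_rnDeriv κ η
  have hκ : η.withDensity (κ.rnDeriv η) = κ :=
    Kernel.ext fun x => Kernel.withDensity_rnDeriv_eq (h x)
  have hκs : IsSFiniteKernel (η.withDensity (κ.rnDeriv η)) := by rw [hκ]; infer_instance
  have hd : (μ ⊗ₘ κ).rnDeriv (μ ⊗ₘ η) =ᵐ[μ ⊗ₘ η] fun y => κ.rnDeriv η y.1 y.2 := by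
    conv_lhs => rw [← hκ, Measure.compProd_withDensity hm]
    exact Measure.rnDeriv_withDensity _ hm
  rw [klDiv_eq_lintegral_klFun_of_ac (.compProd_right (.of_forall h))]
  simp only [klDiv_apply_eq_lintegral_rnDeriv h]
  rw [← Measure.lintegral_compProd (f := fun y =>
    ENNReal.ofReal (klFun (κ.rnDeriv η y.1 y.2).toReal)) (by fun_prop)]
  refine lintegral_congr_ae ?_
  filter_upwards [hd] with y hy
  rw [hy]

end KullbackLeibler

section Measurability

variable {α : Type*} [MeasurableSpace α]

@[fun_prop]
theorem measurable_GFT {x : α → Prices} {v : α → Valuations} (hx : Measurable x)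
    (hv : Measurable v) : Measurable fun a => GFT (x a) (v a) := by
  have h₁ : MeasurableSet {a | (v a).1 ≤ (x a).1.1} := measurableSet_le (by fun_prop) (by fun_prop)
  have h₂ : MeasurableSet {a | (x a).1.1 ≤ (x a).1.2} :=
    measurableSet_le (by fun_prop) (by fun_prop)
  have h₃ : MeasurableSet {a | (x a).1.2 ≤ (v a).2} := measurableSet_le (by fun_prop) (by fun_prop)
  exact Measurable.ite (h₁.inter (h₂.inter h₃)) (by fun_prop) measurable_const

@[fun_prop]
theorem measurable_twoBit {x : α → Prices} {v : α → Valuations} (hx : Measurable x)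
    (hv : Measurable v) : Measurable fun a => twoBit (x a) (v a) := by
  have h₁ : MeasurableSet {a | (v a).1 ≤ (x a).1.1} := measurableSet_le (by fun_prop) (by fun_prop)
  have h₂ : MeasurableSet {a | (x a).1.2 ≤ (v a).2} := measurableSet_le (by fun_prop) (by fun_prop)
  refine (measurable_to_bool ?_).prodMk (measurable_to_bool ?_)
  · simpa [Set.preimage] using h₁
  · simpa [Set.preimage] using h₂

@[fun_prop]
theorem measurable_snoc {β : Type*} [MeasurableSpace β] {n : ℕ} {f : α → Fin n → β} {g : α → β}
    (hf : Measurable f) (hg : Measurable g) :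
    Measurable fun a => (Fin.snoc (α := fun _ => β) (f a) (g a) : Fin (n + 1) → β) := by
  refine measurable_pi_lambda _ (Fin.lastCases ?_ fun j => ?_)
  · simpa only [Fin.snoc_last] using hg
  · simp only [Fin.snoc_castSucc]
    fun_prop

end Measurability

section Transcript

variable {Θ : Type*} [MeasurableSpace Θ] (A : Algorithm Θ)

/-- What the learner has seen before round `T`: its seeds and the feedback of the rounds
`0, …, T - 1`. -/
abbrev Transcript (Θ : Type*) (T : ℕ) : Type _ := (Fin T → Θ) × (Fin T → Bool × Bool)

/-- The transcript extended by a round with seed `θ` and feedback `z`. -/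
def Transcript.extend {T : ℕ} (τ : Transcript Θ T) (θ : Θ) (z : Bool × Bool) :
    Transcript Θ (T + 1) :=
  (Fin.snoc (α := fun _ => Θ) τ.1 θ, Fin.snoc (α := fun _ => Bool × Bool) τ.2 z)

/-- The transcript produced by the seeds and the valuations of the first `T` rounds. -/
noncomputable def Algorithm.transcript {T : ℕ} (h : Fin T → Θ × Valuations) : Transcript Θ T :=
  (fun i => (h i).1, A.feedback T h)

/-- The prices of the next round, given the transcript so far and the seed of that round. -/
noncomputable def Algorithm.nextPrice {T : ℕ} (τ : Transcript Θ T) (θ : Θ) : Prices :=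
  A.price T (Fin.snoc (α := fun _ => Θ) τ.1 θ) τ.2

/-- The prices of round `t`, read off a transcript of `T` rounds. -/
noncomputable def Algorithm.transcriptPrice {T : ℕ} (t : Fin T) (τ : Transcript Θ T) : Prices :=
  A.price t (fun i => τ.1 (i.castLE t.isLt)) (fun i => τ.2 (i.castLE t.isLt.le))

variable {α : Type*} [MeasurableSpace α]

@[fun_prop]
theorem Transcript.measurable_extend {T : ℕ} {τ : α → Transcript Θ T} {θ : α → Θ}
    {z : α → Bool × Bool} (hτ : Measurable τ) (hθ : Measurable θ) (hz : Measurable z) :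
    Measurable fun a => (τ a).extend (θ a) (z a) := by
  unfold Transcript.extend
  fun_prop

@[fun_prop]
theorem Algorithm.measurable_nextPrice {T : ℕ} {τ : α → Transcript Θ T} {θ : α → Θ}
    (hτ : Measurable τ) (hθ : Measurable θ) : Measurable fun a => A.nextPrice (τ a) (θ a) :=
  (A.measurable_price T).comp (by fun_prop : Measurable fun a =>
    (Fin.snoc (α := fun _ => Θ) (τ a).1 (θ a), (τ a).2))

@[fun_prop]
theorem Algorithm.measurable_transcriptPrice {T : ℕ} (t : Fin T) :
    Measurable (A.transcriptPrice t) :=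
  (A.measurable_price t).comp (by fun_prop : Measurable fun τ : Transcript Θ T =>
    ((fun i : Fin (t + 1) => τ.1 (i.castLE t.isLt)), fun i : Fin t => τ.2 (i.castLE t.isLt.le)))

theorem Algorithm.transcript_snoc {T : ℕ} (h : Fin T → Θ × Valuations) (y : Θ × Valuations) :
    A.transcript (Fin.snoc (α := fun _ => Θ × Valuations) h y) =
      (A.transcript h).extend y.1 (twoBit (A.nextPrice (A.transcript h) y.1) y.2) := by
  have hseeds : (fun i => ((Fin.snoc (α := fun _ => Θ × Valuations) h y : Fin (T + 1) → _) i).1) =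
      (Fin.snoc (α := fun _ => Θ) (fun i => (h i).1) y.1 : Fin (T + 1) → Θ) :=
    Fin.comp_snoc (α := Θ × Valuations) Prod.fst h y
  simp only [Algorithm.transcript, Transcript.extend, Algorithm.nextPrice, Algorithm.feedback,
    Fin.snoc_castSucc, Fin.snoc_last, hseeds]

@[fun_prop]
theorem Algorithm.measurable_transcript (T : ℕ) :
    Measurable fun h : Fin T → Θ × Valuations => A.transcript h := by
  induction T with
  | zero => exact measurable_of_subsingleton_codomain _
  | succ T ih =>
    have hsplit : (fun h : Fin (T + 1) → Θ × Valuations => A.transcript h) = fun h =>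
        (A.transcript (Fin.init h)).extend (h (Fin.last T)).1
          (twoBit (A.nextPrice (A.transcript (Fin.init h)) (h (Fin.last T)).1)
            (h (Fin.last T)).2) := by
      funext h
      rw [← A.transcript_snoc, Fin.snoc_init_self]
    have hinit : Measurable fun h : Fin (T + 1) → Θ × Valuations => A.transcript (Fin.init h) :=
      ih.comp (measurable_pi_lambda _ fun i => measurable_pi_apply _)
    rw [hsplit]
    fun_prop

theorem Algorithm.feedback_castLE {t T : ℕ} (htT : t ≤ T) (h : Fin T → Θ × Valuations) :
    A.feedback t (fun i => h (i.castLE htT)) = fun i => A.feedback T h (i.castLE htT) := by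
  induction T, htT using Nat.le_induction with
  | base => rfl
  | succ T htT ih =>
    rw [show (fun i : Fin t => h (i.castLE (htT.trans T.le_succ))) =
      fun i => h (i.castLE htT).castSucc from rfl, ih fun i => h i.castSucc]
    funext i
    exact (Fin.snoc_castSucc (α := fun _ => Bool × Bool) _ _ (i.castLE htT)).symm

theorem Algorithm.transcriptPrice_transcript {T : ℕ} (t : Fin T) (h : Fin T → Θ × Valuations) :
    A.transcriptPrice t (A.transcript h) = A.posted h t := by
  simp only [Algorithm.transcriptPrice, Algorithm.posted, Algorithm.transcript,
    A.feedback_castLE t.isLt.le]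

@[fun_prop]
theorem Algorithm.measurable_posted {T : ℕ} (t : Fin T) :
    Measurable fun h : Fin T → Θ × Valuations => A.posted h t := by
  simp only [← A.transcriptPrice_transcript]
  fun_prop

theorem Algorithm.transcriptPrice_castSucc_extend {T : ℕ} (t : Fin T) (τ : Transcript Θ T) (θ : Θ)
    (z : Bool × Bool) : A.transcriptPrice t.castSucc (τ.extend θ z) = A.transcriptPrice t τ :=
  congrArg₂ (A.price t)
    (funext fun i => Fin.snoc_castSucc (α := fun _ => Θ) θ τ.1 (i.castLE t.isLt))
    (funext fun i => Fin.snoc_castSucc (α := fun _ => Bool × Bool) z τ.2 (i.castLE t.isLt.le))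

theorem Algorithm.transcriptPrice_last_extend {T : ℕ} (τ : Transcript Θ T) (θ : Θ)
    (z : Bool × Bool) : A.transcriptPrice (Fin.last T) (τ.extend θ z) = A.nextPrice τ θ :=
  congrArg (A.price T _) (funext fun i => Fin.snoc_castSucc (α := fun _ => Bool × Bool) z τ.2 i)

end Transcript

section Law

variable {Θ : Type*} [MeasurableSpace Θ] (A : Algorithm Θ) (μ : Measure Valuations)

instance : IsProbabilityMeasure A.seedLaw := A.isProbabilityMeasure_seedLaw

/-- The joint law of the seeds and of the valuations of the first `T` rounds when the valuations
are drawn i.i.d. from `μ`. -/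
noncomputable def Algorithm.iidLaw (T : ℕ) : Measure (Fin T → Θ × Valuations) :=
  Measure.pi fun _ => A.seedLaw.prod μ

/-- The law of the transcript of the first `T` rounds under `A.iidLaw μ T`. -/
noncomputable def Algorithm.transcriptLaw (T : ℕ) : Measure (Transcript Θ T) :=
  (A.iidLaw μ T).map A.transcript

/-- The law of the prices posted in round `t` under `A.iidLaw μ`. -/
noncomputable def Algorithm.priceLaw (t : ℕ) : Measure Prices :=
  ((A.transcriptLaw μ t).prod A.seedLaw).map fun y => A.nextPrice y.1 y.2

/-- The occupation measure of the algorithm: the expected number of rounds among the first `T` in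
which the posted prices lie in a given set. -/
noncomputable def Algorithm.occupation (T : ℕ) : Measure Prices :=
  ∑ t ∈ Finset.range T, A.priceLaw μ t

theorem Algorithm.occupation_succ (T : ℕ) :
    A.occupation μ (T + 1) = A.occupation μ T + A.priceLaw μ T :=
  Finset.sum_range_succ _ _

variable [IsProbabilityMeasure μ]

instance (T : ℕ) : IsProbabilityMeasure (A.iidLaw μ T) := by
  unfold Algorithm.iidLaw; infer_instance

instance (T : ℕ) : IsProbabilityMeasure (A.transcriptLaw μ T) :=
  Measure.isProbabilityMeasure_map (by fun_prop)

instance (t : ℕ) : IsProbabilityMeasure (A.priceLaw μ t) :=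
  Measure.isProbabilityMeasure_map (by fun_prop)

instance (T : ℕ) : IsFiniteMeasure (A.occupation μ T) := by
  unfold Algorithm.occupation; infer_instance

theorem Algorithm.occupation_real (T : ℕ) (S : Set Prices) :
    (A.occupation μ T).real S = ∑ t : Fin T, (A.priceLaw μ t).real S := by
  rw [Fin.sum_univ_eq_sum_range fun t => (A.priceLaw μ t).real S]
  simp only [Algorithm.occupation, Measure.real, Measure.finsetSum_apply]
  exact ENNReal.toReal_sum fun t _ => measure_ne_top _ _

theorem Algorithm.occupation_real_univ (T : ℕ) : (A.occupation μ T).real Set.univ = T := by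
  simp [A.occupation_real]

theorem Algorithm.iidLaw_succ (T : ℕ) :
    A.iidLaw μ (T + 1) = ((A.iidLaw μ T).prod (A.seedLaw.prod μ)).map
      fun x => Fin.snoc (α := fun _ => Θ × Valuations) x.1 x.2 := by
  have h := (measurePreserving_piFinSuccAbove (fun _ : Fin (T + 1) => A.seedLaw.prod μ)
    (Fin.last T)).symm
  rw [Algorithm.iidLaw, ← h.map_eq, ← Measure.prod_swap, Measure.map_map h.measurable
    measurable_swap]
  congr 1
  funext x
  exact Fin.insertNth_last' _ _

theorem jointLaw_iid {σ : ℝ} (hs : IsSmooth σ μ) (T : ℕ) :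
    jointLaw A (Adversary.iid μ inferInstance hs) T = A.iidLaw μ T := by
  induction T with
  | zero =>
    rw [Algorithm.iidLaw, Measure.pi_of_empty _ Fin.elim0]
    rfl
  | succ T ih =>
    rw [A.iidLaw_succ, jointLaw, ih,
      show (Adversary.iid μ inferInstance hs).choice T =
        Kernel.const (Fin T → Θ × Valuations) μ from rfl, Kernel.prod_const, Measure.compProd_const]

theorem Algorithm.priceLaw_prod (t : ℕ) :
    (A.priceLaw μ t).prod μ = ((A.iidLaw μ t).prod (A.seedLaw.prod μ)).map
      fun y => (A.nextPrice (A.transcript y.1) y.2.1, y.2.2) := by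
  refine Measure.ext_of_lintegral _ fun f hf => ?_
  rw [lintegral_prod _ hf.aemeasurable, Algorithm.priceLaw, lintegral_map (by fun_prop)
    (by fun_prop), lintegral_prod _ (by fun_prop), Algorithm.transcriptLaw, lintegral_map
    (by fun_prop) (by fun_prop), lintegral_map hf (by fun_prop), lintegral_prod _ (by fun_prop)]
  refine lintegral_congr fun h => ?_
  rw [lintegral_prod _ (by fun_prop)]

theorem Algorithm.map_posted_valuations {T : ℕ} (t : Fin T) :
    (A.iidLaw μ T).map (fun h => (A.posted h t, (h t).2)) = (A.priceLaw μ t).prod μ := by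
  induction T with
  | zero => exact t.elim0
  | succ T ih =>
    rw [A.iidLaw_succ, Measure.map_map (by fun_prop) (by fun_prop)]
    simp only [Function.comp_def, ← A.transcriptPrice_transcript, A.transcript_snoc]
    cases t using Fin.lastCases with
    | cast t =>
      simp only [A.transcriptPrice_castSucc_extend, A.transcriptPrice_transcript,
        Fin.snoc_castSucc, Fin.val_castSucc]
      rw [← ih t, ← Function.comp_def (fun h => (A.posted h t, (h t).2)) Prod.fst,
        ← Measure.map_map (by fun_prop) measurable_fst, ← Measure.fst, Measure.fst_prod]
    | last =>
      simp only [A.transcriptPrice_last_extend, Fin.snoc_last, Fin.val_last]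
      rw [A.priceLaw_prod]

theorem Algorithm.map_transcriptPrice_transcriptLaw {T : ℕ} (t : Fin T) :
    (A.transcriptLaw μ T).map (A.transcriptPrice t) = A.priceLaw μ t := by
  rw [← Measure.fst_prod (μ := A.priceLaw μ t) (ν := μ), ← A.map_posted_valuations, Measure.fst,
    Measure.map_map measurable_fst (by fun_prop), Algorithm.transcriptLaw,
    Measure.map_map (by fun_prop) (by fun_prop)]
  congr 1
  funext h
  exact A.transcriptPrice_transcript t h

/-- The law of the feedback on posted prices when the valuations have law `μ`. -/
noncomputable def feedbackKernel (μ : Measure Valuations) : Kernel Prices (Bool × Bool) :=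
  (Kernel.id ×ₖ Kernel.const Prices μ).map fun y => twoBit y.1 y.2

instance : IsMarkovKernel (feedbackKernel μ) :=
  Kernel.IsMarkovKernel.map _ (by fun_prop)

theorem feedbackKernel_apply (x : Prices) : feedbackKernel μ x = μ.map (twoBit x) := by
  rw [feedbackKernel, Kernel.map_apply _ (by fun_prop), Kernel.prod_apply, Kernel.id_apply,
    Kernel.const_apply, Measure.dirac_prod, Measure.map_map (by fun_prop) (by fun_prop)]
  rfl

theorem Algorithm.transcriptLaw_succ (T : ℕ) :
    A.transcriptLaw μ (T + 1) =
      ((A.transcriptLaw μ T).prod A.seedLaw ⊗ₘ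
        (feedbackKernel μ).comap (fun y => A.nextPrice y.1 y.2) (by fun_prop)).map
        fun y => y.1.1.extend y.1.2 y.2 := by
  refine Measure.ext_of_lintegral _ fun f hf => ?_
  have hfeedback := Measurable.lintegral_kernel_prod_right'
    (κ := (feedbackKernel μ).comap (fun y : Transcript Θ T × Θ => A.nextPrice y.1 y.2)
      (by fun_prop)) (f := fun y => f (y.1.1.extend y.1.2 y.2)) (by fun_prop)
  rw [Algorithm.transcriptLaw, lintegral_map hf (by fun_prop), A.iidLaw_succ,
    lintegral_map (by fun_prop) (by fun_prop), lintegral_prod _ (by fun_prop),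
    lintegral_map hf (by fun_prop), Measure.lintegral_compProd (by fun_prop),
    lintegral_prod _ hfeedback.aemeasurable, Algorithm.transcriptLaw,
    lintegral_map (by fun_prop) (by fun_prop)]
  refine lintegral_congr fun h => ?_
  rw [lintegral_prod _ (by fun_prop)]
  refine lintegral_congr fun θ => ?_
  simp only [A.transcript_snoc, Kernel.comap_apply, feedbackKernel_apply]
  rw [lintegral_map (by fun_prop) (by fun_prop)]

variable {μ₀ μ₁ : Measure Valuations} [IsProbabilityMeasure μ₀] [IsProbabilityMeasure μ₁]

theorem Algorithm.klDiv_transcriptLaw_le (h : ∀ x, feedbackKernel μ₀ x ≪ feedbackKernel μ₁ x)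
    (T : ℕ) : klDiv (A.transcriptLaw μ₀ T) (A.transcriptLaw μ₁ T) ≤
      ∫⁻ x, klDiv (feedbackKernel μ₀ x) (feedbackKernel μ₁ x) ∂A.occupation μ₀ T := by
  have hD := measurable_klDiv_kernel h
  induction T with
  | zero =>
    rw [show A.transcriptLaw μ₀ 0 = A.transcriptLaw μ₁ 0 by
      simp only [Algorithm.transcriptLaw, Algorithm.iidLaw, Measure.pi_of_empty _ Fin.elim0],
      klDiv_self]
    exact zero_le
  | succ T ih =>
    set g : Transcript Θ T × Θ → Prices := fun y => A.nextPrice y.1 y.2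
    have hg : Measurable g := by fun_prop
    have hac (y) : (feedbackKernel μ₀).comap g hg y ≪ (feedbackKernel μ₁).comap g hg y := h (g y)
    have hround : klDiv ((A.transcriptLaw μ₀ T).prod A.seedLaw)
        ((A.transcriptLaw μ₁ T).prod A.seedLaw) =
          klDiv (A.transcriptLaw μ₀ T) (A.transcriptLaw μ₁ T) := by
      simp only [← Measure.compProd_const, klDiv_compProd_left]
    rw [A.transcriptLaw_succ, A.transcriptLaw_succ, A.occupation_succ, lintegral_add_measure,
      Algorithm.priceLaw, lintegral_map hD hg]
    refine (klDiv_map_le _ _ (by fun_prop)).trans ?_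
    rw [klDiv_compProd_eq_add, hround, klDiv_compProd_eq_lintegral hac]
    exact add_le_add ih le_rfl

theorem Algorithm.occupation_real_sub_le (h : ∀ x, feedbackKernel μ₀ x ≪ feedbackKernel μ₁ x)
    {T : ℕ} (hT : ∫⁻ x, klDiv (feedbackKernel μ₀ x) (feedbackKernel μ₁ x) ∂A.occupation μ₀ T ≠ ∞)
    {S : Set Prices} (hS : MeasurableSet S) :
    (A.occupation μ₁ T).real S - (A.occupation μ₀ T).real S ≤
      T * √(2 * (∫⁻ x, klDiv (feedbackKernel μ₀ x) (feedbackKernel μ₁ x)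
        ∂A.occupation μ₀ T).toReal) := by
  have hKL := A.klDiv_transcriptLaw_le h T
  have hround (t : Fin T) : (A.priceLaw μ₁ t).real S - (A.priceLaw μ₀ t).real S ≤
      √(2 * (∫⁻ x, klDiv (feedbackKernel μ₀ x) (feedbackKernel μ₁ x)
        ∂A.occupation μ₀ T).toReal) := by
    rw [← A.map_transcriptPrice_transcriptLaw μ₁, ← A.map_transcriptPrice_transcriptLaw μ₀,
      map_measureReal_apply (by fun_prop) hS, map_measureReal_apply (by fun_prop) hS]
    refine (measureReal_sub_le_sqrt_klDiv (ne_top_of_le_ne_top hT hKL) _).trans ?_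
    gcongr
  rw [A.occupation_real, A.occupation_real, ← Finset.sum_sub_distrib]
  refine (Finset.sum_le_card_nsmul _ _ _ fun t _ => hround t).trans_eq ?_
  rw [Finset.card_univ, Fintype.card_fin, nsmul_eq_mul]

end Law

section Regret

/-- The expected gain from trade of the prices `x` when the valuations have law `μ`. -/
noncomputable def expectedGFT (μ : Measure Valuations) (x : Prices) : ℝ := ∫ v, GFT x v ∂μ

theorem GFT_nonneg (x : Prices) (v : Valuations) : 0 ≤ GFT x v := by
  unfold GFT
  split_ifs with h
  · have h₁ : (v.1 : ℝ) ≤ x.1.1 := h.1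
    have h₂ : (x.1.2 : ℝ) ≤ v.2 := h.2.2
    linarith
  · exact le_rfl

theorem GFT_le_one (x : Prices) (v : Valuations) : GFT x v ≤ 1 := by
  unfold GFT
  split_ifs with h
  · have hx : (x.1.1 : ℝ) ≤ x.1.2 := h.2.1
    linarith [v.1.2.1, v.2.2.2]
  · exact zero_le_one

theorem abs_GFT_sub_le (x y : Prices) (v : Valuations) : |GFT x v - GFT y v| ≤ 1 :=
  abs_sub_le_of_nonneg_of_le (GFT_nonneg x v) (GFT_le_one x v) (GFT_nonneg y v) (GFT_le_one y v)

@[fun_prop]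
theorem measurable_expectedGFT (μ : Measure Valuations) [SFinite μ] :
    Measurable (expectedGFT μ) :=
  (StronglyMeasurable.integral_prod_right' (f := fun y : Prices × Valuations => GFT y.1 y.2)
    (by fun_prop : Measurable _).stronglyMeasurable).measurable

variable (μ : Measure Valuations) [IsProbabilityMeasure μ]

theorem integrable_GFT (x : Prices) : Integrable (GFT x) μ :=
  .of_bound (by fun_prop : Measurable fun v => GFT x v).aestronglyMeasurable 1
    (.of_forall fun v => by
      rw [Real.norm_of_nonneg (GFT_nonneg x v)]
      exact GFT_le_one x v)

theorem expectedGFT_sub (x y : Prices) :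
    expectedGFT μ x - expectedGFT μ y = ∫ v, (GFT x v - GFT y v) ∂μ :=
  (integral_sub (integrable_GFT μ x) (integrable_GFT μ y)).symm

theorem abs_expectedGFT_sub_le (x y : Prices) : |expectedGFT μ x - expectedGFT μ y| ≤ 1 := by
  rw [expectedGFT_sub]
  simpa using norm_integral_le_of_norm_le_const (μ := μ) (f := fun v => GFT x v - GFT y v)
    (.of_forall (abs_GFT_sub_le x y))

variable {Θ : Type*} [MeasurableSpace Θ] (A : Algorithm Θ)

theorem integrable_expectedGFT_sub (ν : Measure Prices) [IsFiniteMeasure ν] (x : Prices) :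
    Integrable (fun y => expectedGFT μ x - expectedGFT μ y) ν :=
  .of_bound (by fun_prop : Measurable _).aestronglyMeasurable 1
    (.of_forall (abs_expectedGFT_sub_le μ x))

theorem Algorithm.integral_GFT_sub_posted {T : ℕ} (t : Fin T) (x : Prices) :
    ∫ h, (GFT x (h t).2 - GFT (A.posted h t) (h t).2) ∂A.iidLaw μ T =
      ∫ y, (expectedGFT μ x - expectedGFT μ y) ∂A.priceLaw μ t := by
  have hm : Measurable fun y : Prices × Valuations => GFT x y.2 - GFT y.1 y.2 := by fun_prop
  have hint : Integrable (fun y => GFT x y.2 - GFT y.1 y.2) ((A.priceLaw μ t).prod μ) :=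
    .of_bound hm.aestronglyMeasurable 1 (.of_forall fun y => abs_GFT_sub_le x y.1 y.2)
  simp only [expectedGFT_sub]
  rw [← integral_prod _ hint, ← A.map_posted_valuations,
    integral_map (by fun_prop) hm.aestronglyMeasurable]

theorem Algorithm.integral_sum_GFT_sub_posted (T : ℕ) (x : Prices) :
    ∫ h, ((∑ t : Fin T, GFT x (h t).2) - ∑ t : Fin T, GFT (A.posted h t) (h t).2) ∂A.iidLaw μ T =
      ∫ y, (expectedGFT μ x - expectedGFT μ y) ∂A.occupation μ T := by
  simp only [← Finset.sum_sub_distrib]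
  rw [integral_finsetSum _ fun t _ => .of_bound
    (by fun_prop : Measurable _).aestronglyMeasurable 1 (.of_forall fun h => abs_GFT_sub_le x _ _)]
  simp only [A.integral_GFT_sub_posted μ]
  rw [Fin.sum_univ_eq_sum_range fun t => ∫ y, (expectedGFT μ x - expectedGFT μ y) ∂A.priceLaw μ t,
    Algorithm.occupation, integral_finsetSum_measure fun t _ => integrable_expectedGFT_sub μ _ x]

theorem integral_occupation_le_regret {σ : ℝ} (hs : IsSmooth σ μ) (T : ℕ) (x : Prices) :
    ∫ y, (expectedGFT μ x - expectedGFT μ y) ∂A.occupation μ T ≤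
      regret A (Adversary.iid μ inferInstance hs) T := by
  simp only [regret, jointLaw_iid A μ hs, A.integral_sum_GFT_sub_posted μ]
  refine le_ciSup (f := fun x => ∫ y, (expectedGFT μ x - expectedGFT μ y) ∂A.occupation μ T)
    ⟨1 * T, ?_⟩ x
  rintro _ ⟨x, rfl⟩
  rw [← A.occupation_real_univ μ T]
  exact (Real.le_norm_self _).trans
    (norm_integral_le_of_norm_le_const (.of_forall (abs_expectedGFT_sub_le μ x)))

theorem mul_occupation_real_le_regret {σ : ℝ} (hs : IsSmooth σ μ) (T : ℕ) {x : Prices}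
    (hx : ∀ y, expectedGFT μ y ≤ expectedGFT μ x) {c : ℝ} (hc : 0 ≤ c) {S : Set Prices}
    (hS : ∀ y ∈ S, expectedGFT μ y + c ≤ expectedGFT μ x) :
    c * (A.occupation μ T).real S ≤ regret A (Adversary.iid μ inferInstance hs) T :=
  calc c * (A.occupation μ T).real S
      ≤ c * (A.occupation μ T).real {y | c ≤ expectedGFT μ x - expectedGFT μ y} := by
        gcongr
        · exact measure_ne_top _ _
        · exact fun y hy => le_sub_iff_add_le'.2 (hS y hy)
    _ ≤ ∫ y, (expectedGFT μ x - expectedGFT μ y) ∂A.occupation μ T :=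
        mul_meas_ge_le_integral_of_nonneg (.of_forall fun y => sub_nonneg.2 (hx y))
          (integrable_expectedGFT_sub μ _ x) c
    _ ≤ regret A (Adversary.iid μ inferInstance hs) T := integral_occupation_le_regret μ A hs T x

end Regret

section Wave

/-- The square wave that is `1` on `(a, a + d]`, `-1` on `(a + d, a + 2 d]` and `0` elsewhere. The
hard instances add a product of two square waves to a density. -/
noncomputable def wave (a d x : ℝ) : ℝ :=
  (Set.Ioc a (a + d)).indicator 1 x - (Set.Ioc (a + d) (a + 2 * d)).indicator 1 x

@[fun_prop]
theorem measurable_wave (a d : ℝ) : Measurable (wave a d) :=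
  (measurable_one.indicator measurableSet_Ioc).sub (measurable_one.indicator measurableSet_Ioc)

theorem wave_of_notMem {a d x : ℝ} (hd : 0 ≤ d) (hx : x ∉ Set.Ioc a (a + 2 * d)) :
    wave a d x = 0 := by
  rw [wave, Set.indicator_of_notMem, Set.indicator_of_notMem, sub_zero]
  · exact fun h => hx ⟨by linarith [h.1], h.2⟩
  · exact fun h => hx ⟨h.1, by linarith [h.2]⟩

theorem wave_eq_ite (a d x : ℝ) :
    wave a d x = (if x ∈ Set.Ioc a (a + d) then 1 else 0) -
      if x ∈ Set.Ioc (a + d) (a + 2 * d) then 1 else 0 := by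
  simp only [wave, Set.indicator_apply, Pi.one_apply]

theorem abs_wave_le_one (a d x : ℝ) : |wave a d x| ≤ 1 := by
  rw [wave_eq_ite]
  split_ifs <;> norm_num

theorem integral_indicator_Ioc {u v : ℝ} (hu : 0 ≤ u) (huv : u ≤ v) (hv : v ≤ 1) (g : ℝ → ℝ) :
    ∫ s : unitInterval, (Set.Ioc u v).indicator g s = ∫ x in u..v, g x := by
  rw [unitInterval.measurePreserving_coe.integral_comp unitInterval.measurableEmbedding_coe
    ((Set.Ioc u v).indicator g), setIntegral_indicator measurableSet_Ioc,
    intervalIntegral.integral_of_le huv]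
  congr 2
  exact Set.inter_eq_right.2 fun x hx => ⟨hu.trans hx.1.le, hx.2.trans hv⟩

theorem integrable_indicator_Ioc {g : ℝ → ℝ} (hg : Continuous g) (u v : ℝ) :
    Integrable fun s : unitInterval => (Set.Ioc u v).indicator g s := by
  have hgs : Integrable fun s : unitInterval => g s :=
    (hg.comp continuous_subtype_val).integrable_of_hasCompactSupport
      (HasCompactSupport.of_compactSpace _)
  exact hgs.indicator (measurable_subtype_coe (measurableSet_Ioc (a := u) (b := v)))

variable {a d : ℝ} {f : unitInterval → ℝ}

theorem integral_wave_mul (ha : 0 ≤ a) (hd : 0 ≤ d) (had : a + 2 * d ≤ 1) {g : ℝ → ℝ}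
    (hg : Continuous g) (h : ∀ s : unitInterval, (s : ℝ) ∈ Set.Ioc a (a + 2 * d) → f s = g s) :
    ∫ s : unitInterval, wave a d s * f s =
      (∫ x in a..a + d, g x) - ∫ x in (a + d)..(a + 2 * d), g x := by
  have hwave (s : unitInterval) : wave a d s * f s = (Set.Ioc a (a + d)).indicator g s -
      (Set.Ioc (a + d) (a + 2 * d)).indicator g s := by
    by_cases hs : (s : ℝ) ∈ Set.Ioc a (a + 2 * d)
    · simp only [h s hs, wave, sub_mul, ← Set.indicator_mul_left, Pi.one_apply, one_mul]
    · rw [wave_of_notMem hd hs, Set.indicator_of_notMem, Set.indicator_of_notMem, zero_mul,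
        sub_zero]
      · exact fun h => hs ⟨by linarith [h.1], h.2⟩
      · exact fun h => hs ⟨h.1, by linarith [h.2]⟩
  simp only [hwave]
  rw [integral_sub (integrable_indicator_Ioc hg _ _) (integrable_indicator_Ioc hg _ _),
    integral_indicator_Ioc ha (by linarith) (by linarith),
    integral_indicator_Ioc (by linarith) (by linarith) had]

theorem integral_wave_mul_const (ha : 0 ≤ a) (hd : 0 ≤ d) (had : a + 2 * d ≤ 1) {c : ℝ}
    (h : ∀ s : unitInterval, (s : ℝ) ∈ Set.Ioc a (a + 2 * d) → f s = c) :
    ∫ s : unitInterval, wave a d s * f s = 0 := by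
  rw [integral_wave_mul ha hd had (g := fun _ => c) continuous_const h,
    intervalIntegral.integral_const, intervalIntegral.integral_const, smul_eq_mul, smul_eq_mul]
  ring

theorem integral_wave_mul_id (ha : 0 ≤ a) (hd : 0 ≤ d) (had : a + 2 * d ≤ 1)
    (h : ∀ s : unitInterval, (s : ℝ) ∈ Set.Ioc a (a + 2 * d) → f s = s) :
    ∫ s : unitInterval, wave a d s * f s = -d ^ 2 := by
  rw [integral_wave_mul ha hd had (g := fun x => x) continuous_id h, integral_id, integral_id]
  ring

theorem integral_wave_mul_le (ha : 0 ≤ a) (hd : 0 ≤ d) (had : a + 2 * d ≤ 1)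
    (hf : Measurable f) (hf₀ : ∀ s, 0 ≤ f s) (hf₁ : ∀ s, f s ≤ 1) :
    ∫ s : unitInterval, wave a d s * f s ≤ d := by
  have hint : Integrable fun s : unitInterval => wave a d s * f s :=
    .of_bound (by fun_prop : Measurable _).aestronglyMeasurable 1 (.of_forall fun s => by
      rw [norm_mul, Real.norm_of_nonneg (hf₀ s)]
      exact mul_le_one₀ (abs_wave_le_one _ _ _) (hf₀ s) (hf₁ s))
  calc ∫ s : unitInterval, wave a d s * f s
      ≤ ∫ s : unitInterval, (Set.Ioc a (a + d)).indicator (fun _ => 1) (s : ℝ) := by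
        refine integral_mono hint (integrable_indicator_Ioc continuous_const _ _) fun s => ?_
        simp only [wave_eq_ite, Set.indicator_apply]
        split_ifs <;> linarith [hf₀ s, hf₁ s]
    _ = d := by
        rw [integral_indicator_Ioc ha (by linarith) (by linarith)]
        simp

theorem abs_integral_wave_mul_le (ha : 0 ≤ a) (hd : 0 ≤ d) (had : a + 2 * d ≤ 1)
    (hf : ∀ s, |f s| ≤ 1) : |∫ s : unitInterval, wave a d s * f s| ≤ 2 * d := by
  rw [← Real.norm_eq_abs]
  calc ‖∫ s : unitInterval, wave a d s * f s‖
      ≤ ∫ s : unitInterval, (Set.Ioc a (a + 2 * d)).indicator (fun _ => 1) (s : ℝ) := by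
        refine norm_integral_le_of_norm_le (integrable_indicator_Ioc continuous_const _ _)
          (.of_forall fun s => ?_)
        by_cases hs : (s : ℝ) ∈ Set.Ioc a (a + 2 * d)
        · rw [Set.indicator_of_mem hs, norm_mul]
          exact mul_le_one₀ (abs_wave_le_one _ _ _) (norm_nonneg _) (hf s)
        · rw [wave_of_notMem hd hs, Set.indicator_of_notMem hs, zero_mul, norm_zero]
    _ = 2 * d := by
        rw [integral_indicator_Ioc ha (by linarith) had]
        simp

end Wave

section LawOf

/-- The measure on `[0,1]²` with density `f` with respect to the uniform distribution; negative
values of `f` count as `0`. -/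
noncomputable def lawOf (f : Valuations → ℝ) : Measure Valuations :=
  volume.withDensity fun v => ENNReal.ofReal (f v)

variable {f : Valuations → ℝ}

theorem isSmooth_lawOf {σ : ℝ} (hσ : 0 < σ) (hf : ∀ v, f v ≤ σ⁻¹) : IsSmooth σ (lawOf f) := by
  intro S hS
  rw [lawOf, withDensity_apply _ hS]
  calc ∫⁻ v in S, ENNReal.ofReal (f v) ≤ ∫⁻ _ in S, ENNReal.ofReal (σ⁻¹) :=
        lintegral_mono fun v => ENNReal.ofReal_le_ofReal (hf v)
    _ = volume S / ENNReal.ofReal σ := by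
        rw [setLIntegral_const, ENNReal.ofReal_inv_of_pos hσ, mul_comm, div_eq_mul_inv]

theorem integral_lawOf (hf : Measurable f) (hf₀ : ∀ v, 0 ≤ f v) (g : Valuations → ℝ) :
    ∫ v, g v ∂lawOf f = ∫ v, f v * g v := by
  rw [lawOf, integral_withDensity_eq_integral_toReal_smul hf.ennreal_ofReal
    (.of_forall fun v => ENNReal.ofReal_lt_top)]
  simp only [ENNReal.toReal_ofReal (hf₀ _), smul_eq_mul]

theorem isProbabilityMeasure_lawOf (hf₀ : ∀ v, 0 ≤ f v) (hf₁ : ∫ v, f v = 1) :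
    IsProbabilityMeasure (lawOf f) := by
  have hint : Integrable f := .of_integral_ne_zero (by rw [hf₁]; exact one_ne_zero)
  refine ⟨?_⟩
  rw [lawOf, withDensity_apply _ .univ, setLIntegral_univ,
    ← ofReal_integral_eq_lintegral_ofReal hint (.of_forall hf₀), hf₁, ENNReal.ofReal_one]

theorem measureReal_le_lawOf_real (hf : Measurable f) [IsFiniteMeasure (lawOf f)]
    {S : Set Valuations} (hS : MeasurableSet S) (h : ∀ v ∈ S, 1 ≤ f v) :
    volume.real S ≤ (lawOf f).real S := by
  refine ENNReal.toReal_mono (measure_ne_top _ _) ?_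
  rw [lawOf, withDensity_apply _ hS, ← setLIntegral_one]
  exact setLIntegral_mono hf.ennreal_ofReal fun v hv => ENNReal.one_le_ofReal.2 (h v hv)

end LawOf

section Diagonal

/-- The single price `p`, posted to both sides. -/
def diag (p : unitInterval) : Prices := ⟨(p, p), le_rfl⟩

theorem GFT_diag (p : unitInterval) (v : Valuations) :
    GFT (diag p) v = if v.1 ≤ p ∧ p ≤ v.2 then (v.2 : ℝ) - v.1 else 0 := by
  simp only [GFT, diag, le_refl, true_and]
  split_ifs <;> ring

theorem GFT_le_GFT_diag (x : Prices) (v : Valuations) : GFT x v ≤ GFT (diag x.1.1) v := by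
  by_cases h : v.1 ≤ x.1.1 ∧ x.1.1 ≤ x.1.2 ∧ x.1.2 ≤ v.2
  · have hx : (x.1.1 : ℝ) ≤ x.1.2 := x.2
    rw [GFT_diag, GFT, if_pos h, if_pos ⟨h.1, h.2.1.trans h.2.2⟩]
    linarith
  · rw [GFT, if_neg h]
    exact GFT_nonneg _ _

theorem expectedGFT_le_diag (μ : Measure Valuations) [IsProbabilityMeasure μ] (x : Prices) :
    expectedGFT μ x ≤ expectedGFT μ (diag x.1.1) :=
  integral_mono (integrable_GFT μ _) (integrable_GFT μ _) (GFT_le_GFT_diag x)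

end Diagonal

section Band

/-- The band `{(s, b) | s ≤ b ≤ s + 3/8}`. The uniform distribution on it gives all the single
prices in `[3/8, 5/8]` the same gain from trade. -/
def band : Set Valuations := {v | (v.1 : ℝ) ≤ v.2 ∧ (v.2 : ℝ) - v.1 ≤ 3 / 8}

theorem measurableSet_band : MeasurableSet band := by
  have h₁ : MeasurableSet {v : Valuations | (v.1 : ℝ) ≤ v.2} :=
    measurableSet_le (by fun_prop) (by fun_prop)
  have h₂ : MeasurableSet {v : Valuations | (v.2 : ℝ) - v.1 ≤ 3 / 8} :=
    measurableSet_le (by fun_prop) (by fun_prop)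
  exact h₁.inter h₂

/-- The points of the plane at which the single price `p` leads to a trade of gain at most `3/8`. -/
def tradeRegion (p : ℝ) : Set (ℝ × ℝ) := {y | y.1 ≤ p ∧ p ≤ y.2 ∧ y.2 - y.1 ≤ 3 / 8}

theorem measurableSet_tradeRegion (p : ℝ) : MeasurableSet (tradeRegion p) := by
  have h₁ : MeasurableSet {y : ℝ × ℝ | y.1 ≤ p} := measurableSet_le (by fun_prop) (by fun_prop)
  have h₂ : MeasurableSet {y : ℝ × ℝ | p ≤ y.2} := measurableSet_le (by fun_prop) (by fun_prop)
  have h₃ : MeasurableSet {y : ℝ × ℝ | y.2 - y.1 ≤ 3 / 8} :=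
    measurableSet_le (by fun_prop) (by fun_prop)
  exact h₁.inter (h₂.inter h₃)

theorem tradeRegion_subset {q : ℝ} (hq : q ∈ Set.Icc (3 / 8) (5 / 8)) :
    tradeRegion q ⊆ Set.Icc 0 1 ×ˢ Set.Icc 0 1 := fun y hy =>
  ⟨⟨by linarith [hy.2.1, hy.2.2, hq.1], by linarith [hy.1, hq.2]⟩,
    ⟨by linarith [hy.2.1, hq.1], by linarith [hy.1, hy.2.2, hq.2]⟩⟩

-- Translation along the diagonal carries `tradeRegion p` to `tradeRegion q` and preserves gains.
theorem setLIntegral_tradeRegion_eq (p q : ℝ) :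
    ∫⁻ y in tradeRegion p, ENNReal.ofReal (y.2 - y.1) =
      ∫⁻ y in tradeRegion q, ENNReal.ofReal (y.2 - y.1) := by
  rw [← lintegral_indicator (measurableSet_tradeRegion p),
    ← lintegral_indicator (measurableSet_tradeRegion q),
    ← lintegral_add_right_eq_self _ ((p - q, p - q) : ℝ × ℝ)]
  refine lintegral_congr fun y => ?_
  have hmem : y + (p - q, p - q) ∈ tradeRegion p ↔ y ∈ tradeRegion q := by
    simp only [tradeRegion, Set.mem_ofPred_eq, Prod.fst_add, Prod.snd_add, add_sub_add_right_eq_sub]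
    constructor <;> rintro ⟨h₁, h₂, h₃⟩ <;> exact ⟨by linarith, by linarith, h₃⟩
  by_cases hy : y ∈ tradeRegion q
  · rw [Set.indicator_of_mem hy, Set.indicator_of_mem (hmem.2 hy), Prod.fst_add, Prod.snd_add,
      add_sub_add_right_eq_sub]
  · rw [Set.indicator_of_notMem hy, Set.indicator_of_notMem (mt hmem.1 hy)]

theorem lintegral_valuations {F : ℝ × ℝ → ℝ≥0∞} (hF : Measurable F) :
    ∫⁻ v : Valuations, F (v.1, v.2) = ∫⁻ y in Set.Icc 0 1 ×ˢ Set.Icc 0 1, F y := by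
  have h := unitInterval.measurePreserving_coe.prod unitInterval.measurePreserving_coe
  rw [Measure.prod_restrict] at h
  exact h.lintegral_comp hF

theorem setLIntegral_band_GFT_diag (p : unitInterval) :
    ∫⁻ v in band, ENNReal.ofReal (GFT (diag p) v) =
      ∫⁻ y in Set.Icc 0 1 ×ˢ Set.Icc 0 1 ∩ tradeRegion p, ENNReal.ofReal (y.2 - y.1) := by
  rw [Set.inter_comm, ← Measure.restrict_restrict (measurableSet_tradeRegion p),
    ← lintegral_indicator (measurableSet_tradeRegion p), ← lintegral_valuations
      (Measurable.indicator (by fun_prop) (measurableSet_tradeRegion p)),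
    ← lintegral_indicator measurableSet_band]
  refine lintegral_congr fun v => ?_
  by_cases hv : ((v.1 : ℝ), (v.2 : ℝ)) ∈ tradeRegion p
  · rw [Set.indicator_of_mem hv, Set.indicator_of_mem (show v ∈ band from
      ⟨hv.1.trans hv.2.1, hv.2.2⟩), GFT_diag, if_pos ⟨hv.1, hv.2.1⟩]
  · rw [Set.indicator_of_notMem hv, Set.indicator_apply_eq_zero]
    intro hb
    rw [GFT_diag, if_neg fun h => hv ⟨h.1, h.2, hb.2⟩, ENNReal.ofReal_zero]

theorem setIntegral_band_GFT_diag_le (p : unitInterval) {q : unitInterval}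
    (hq : (q : ℝ) ∈ Set.Icc (3 / 8) (5 / 8)) :
    ∫ v in band, GFT (diag p) v ≤ ∫ v in band, GFT (diag q) v := by
  rw [← ENNReal.ofReal_le_ofReal_iff (integral_nonneg (GFT_nonneg _)),
    ofReal_integral_eq_lintegral_ofReal (integrable_GFT _ _).integrableOn
      (.of_forall (GFT_nonneg _)),
    ofReal_integral_eq_lintegral_ofReal (integrable_GFT _ _).integrableOn
      (.of_forall (GFT_nonneg _)), setLIntegral_band_GFT_diag, setLIntegral_band_GFT_diag,
    Set.inter_eq_right.2 (tradeRegion_subset hq), setLIntegral_tradeRegion_eq q p]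
  exact lintegral_mono_set Set.inter_subset_right

end Band

section BaseLaw

/-- The rectangle `[u, u'] × [w, w']`. -/
def box (u u' w w' : ℝ) : Set Valuations :=
  {v | (v.1 : ℝ) ∈ Set.Icc u u' ∧ (v.2 : ℝ) ∈ Set.Icc w w'}

theorem measurableSet_box (u u' w w' : ℝ) : MeasurableSet (box u u' w w') :=
  (measurable_fst.subtype_val measurableSet_Icc).inter
    (measurable_snd.subtype_val measurableSet_Icc)

theorem volumeReal_box {u u' w w' : ℝ} (hu : 0 ≤ u) (huu : u ≤ u') (hu' : u' ≤ 1) (hw : 0 ≤ w)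
    (hww : w ≤ w') (hw' : w' ≤ 1) : volume.real (box u u' w w') = (u' - u) * (w' - w) := by
  have hbox : box u u' w w' =
      Set.Icc (⟨u, hu, huu.trans hu'⟩ : unitInterval) ⟨u', hu.trans huu, hu'⟩ ×ˢ
        Set.Icc (⟨w, hw, hww.trans hw'⟩ : unitInterval) ⟨w', hw.trans hww, hw'⟩ := rfl
  rw [hbox, Measure.volume_eq_prod, measureReal_prod_prod]
  simp only [Measure.real, unitInterval.volume_Icc]
  rw [ENNReal.toReal_ofReal (by linarith), ENNReal.toReal_ofReal (by linarith)]

/-- The corners `(0, 1)` and `(1, 0)` of the square. They carry the mass of the base law outside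
the band: a pair of prices far from the diagonal loses trades at the first one, and both are
needed for every feedback to have a probability bounded below. -/
def corner : Set Valuations := box 0 (1 / 4) (3 / 4) 1 ∪ box (3 / 4) 1 0 (1 / 4)

theorem measurableSet_corner : MeasurableSet corner :=
  (measurableSet_box _ _ _ _).union (measurableSet_box _ _ _ _)

theorem disjoint_band_corner : Disjoint band corner := by
  refine Set.disjoint_left.2 fun v hv => ?_
  rintro (h | h)
  · linarith [hv.2, h.1.2, h.2.1]
  · linarith [hv.1, h.1.1, h.2.2]

theorem volumeReal_corner : volume.real corner = 1 / 8 := by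
  have hdisj : Disjoint (box 0 (1 / 4) (3 / 4) 1) (box (3 / 4) 1 0 (1 / 4)) :=
    Set.disjoint_left.2 fun v h₁ h₂ => by linarith [h₁.1.2, h₂.1.1]
  rw [corner, measureReal_union hdisj (measurableSet_box _ _ _ _), volumeReal_box, volumeReal_box]
    <;> norm_num

/-- The density of the base law on the corners, which makes its total mass `1`. -/
noncomputable def cornerDensity : ℝ := 8 * (1 - volume.real band)

theorem cornerDensity_le : cornerDensity ≤ 8 := by
  unfold cornerDensity
  linarith [measureReal_nonneg (μ := volume) (s := band)]

theorem one_le_cornerDensity : 1 ≤ cornerDensity := by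
  have hsub : band ⊆ (box (5 / 8) 1 0 (3 / 8))ᶜ := fun v hv h => by
    linarith [hv.1, h.1.1, h.2.2]
  have hle := measureReal_mono (μ := volume) hsub
  rw [probReal_compl_eq_one_sub (measurableSet_box _ _ _ _), volumeReal_box (by norm_num)
    (by norm_num) (by norm_num) (by norm_num) (by norm_num) (by norm_num)] at hle
  unfold cornerDensity
  linarith

/-- The density of the base law: `1` on the band and `cornerDensity` on the corners. -/
noncomputable def baseDensity (v : Valuations) : ℝ :=
  band.indicator 1 v + cornerDensity * corner.indicator 1 v

@[fun_prop]
theorem measurable_baseDensity : Measurable baseDensity :=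
  (measurable_one.indicator measurableSet_band).add
    ((measurable_one.indicator measurableSet_corner).const_mul _)

theorem baseDensity_of_mem_band {v : Valuations} (hv : v ∈ band) : baseDensity v = 1 := by
  simp [baseDensity, hv, disjoint_band_corner.notMem_of_mem_left hv]

theorem baseDensity_of_mem_corner {v : Valuations} (hv : v ∈ corner) :
    baseDensity v = cornerDensity := by
  simp [baseDensity, hv, disjoint_band_corner.notMem_of_mem_right hv]

theorem baseDensity_nonneg (v : Valuations) : 0 ≤ baseDensity v :=
  add_nonneg (Set.indicator_nonneg (fun _ _ => zero_le_one) _)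
    (mul_nonneg (by linarith [one_le_cornerDensity])
      (Set.indicator_nonneg (fun _ _ => zero_le_one) _))

theorem baseDensity_le (v : Valuations) : baseDensity v ≤ 8 := by
  by_cases hv : v ∈ corner
  · exact (baseDensity_of_mem_corner hv).trans_le cornerDensity_le
  · rw [baseDensity, Set.indicator_of_notMem hv, mul_zero, add_zero]
    exact (Set.indicator_le_self' (fun _ _ => zero_le_one) v).trans (by norm_num)

theorem integral_baseDensity_mul {g : Valuations → ℝ} (hg : Integrable g) :
    ∫ v, baseDensity v * g v = (∫ v in band, g v) + cornerDensity * ∫ v in corner, g v := by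
  rw [← integral_indicator measurableSet_band, ← integral_indicator measurableSet_corner,
    ← integral_const_mul, ← integral_add (hg.indicator measurableSet_band)
      ((hg.indicator measurableSet_corner).const_mul _)]
  simp only [baseDensity, add_mul, mul_assoc, ← Set.indicator_mul_left, Pi.one_apply, one_mul]

theorem integral_baseDensity : ∫ v, baseDensity v = 1 := by
  have h := integral_baseDensity_mul (g := fun _ => 1) (integrable_const _)
  simp only [mul_one, integral_const, measureReal_restrict_apply_univ, volumeReal_corner,
    cornerDensity, smul_eq_mul] at h
  linarith

/-- The law that the other hard instances perturb. Every single price in `[3/8, 5/8]` is optimal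
for it. -/
noncomputable def baseLaw : Measure Valuations := lawOf baseDensity

instance : IsProbabilityMeasure baseLaw :=
  isProbabilityMeasure_lawOf baseDensity_nonneg integral_baseDensity

theorem volumeReal_le_baseLaw_real {S : Set Valuations} (hS : MeasurableSet S)
    (h : S ⊆ band ∪ corner) : volume.real S ≤ baseLaw.real S := by
  have : IsFiniteMeasure (lawOf baseDensity) := inferInstanceAs (IsFiniteMeasure baseLaw)
  refine measureReal_le_lawOf_real measurable_baseDensity hS fun v hv => ?_
  rcases h hv with hv | hv
  · exact (baseDensity_of_mem_band hv).ge
  · exact one_le_cornerDensity.trans_eq (baseDensity_of_mem_corner hv).symm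

theorem expectedGFT_baseLaw (x : Prices) :
    expectedGFT baseLaw x =
      (∫ v in band, GFT x v) + cornerDensity * ∫ v in corner, GFT x v := by
  rw [expectedGFT, baseLaw, integral_lawOf measurable_baseDensity baseDensity_nonneg,
    integral_baseDensity_mul (integrable_GFT _ x)]

theorem GFT_diag_le_of_mem_corner (p : unitInterval) {q : unitInterval}
    (hq : (q : ℝ) ∈ Set.Icc (3 / 8) (5 / 8)) {v : Valuations} (hv : v ∈ corner) :
    GFT (diag p) v ≤ GFT (diag q) v := by
  rcases hv with hv | hv
  · have hsq : v.1 ≤ q := Subtype.coe_le_coe.1 (by linarith [hv.1.2, hq.1])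
    have hqb : q ≤ v.2 := Subtype.coe_le_coe.1 (by linarith [hv.2.1, hq.2])
    rw [GFT_diag p, GFT_diag q, if_pos (show v.1 ≤ q ∧ q ≤ v.2 from ⟨hsq, hqb⟩)]
    split_ifs
    · exact le_rfl
    · linarith [hv.1.2, hv.2.1]
  · rw [GFT_diag, if_neg]
    · exact GFT_nonneg _ _
    · rintro ⟨hsp, hpb⟩
      have : (v.1 : ℝ) ≤ v.2 := hsp.trans hpb
      linarith [hv.1.1, hv.2.2]

theorem expectedGFT_baseLaw_diag_le (p : unitInterval) {q : unitInterval}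
    (hq : (q : ℝ) ∈ Set.Icc (3 / 8) (5 / 8)) :
    expectedGFT baseLaw (diag p) ≤ expectedGFT baseLaw (diag q) := by
  rw [expectedGFT_baseLaw, expectedGFT_baseLaw]
  exact add_le_add (setIntegral_band_GFT_diag_le p hq) (mul_le_mul_of_nonneg_left
    (setIntegral_mono_on (integrable_GFT _ _).integrableOn (integrable_GFT _ _).integrableOn
      measurableSet_corner fun v hv => GFT_diag_le_of_mem_corner p hq hv)
    (by linarith [one_le_cornerDensity]))

theorem expectedGFT_baseLaw_le {q : unitInterval} (hq : (q : ℝ) ∈ Set.Icc (3 / 8) (5 / 8))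
    (x : Prices) : expectedGFT baseLaw x ≤ expectedGFT baseLaw (diag q) :=
  (expectedGFT_le_diag baseLaw x).trans (expectedGFT_baseLaw_diag_le x.1.1 hq)

end BaseLaw

section Perturbation

/-- The perturbation of the base density on `(a, a + 2 d] × (5/8, 3/4]`. It is a product of two
square waves, hence has mean `0` along every row and every column. -/
noncomputable def perturbation (a d : ℝ) (v : Valuations) : ℝ :=
  -(wave a d v.1 * wave (5 / 8) (1 / 16) v.2)

@[fun_prop]
theorem measurable_perturbation (a d : ℝ) : Measurable (perturbation a d) := by
  unfold perturbation
  fun_prop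

theorem abs_perturbation_le_one (a d : ℝ) (v : Valuations) : |perturbation a d v| ≤ 1 := by
  rw [perturbation, abs_neg, abs_mul]
  exact mul_le_one₀ (abs_wave_le_one _ _ _) (abs_nonneg _) (abs_wave_le_one _ _ _)

theorem integral_perturbation_mul (a d : ℝ) (f g : unitInterval → ℝ) :
    ∫ v, perturbation a d v * (f v.1 * g v.2) =
      -((∫ s : unitInterval, wave a d s * f s) *
        ∫ b : unitInterval, wave (5 / 8) (1 / 16) b * g b) := by
  rw [← integral_prod_mul, ← integral_neg, ← Measure.volume_eq_prod]
  simp only [perturbation, neg_mul, mul_mul_mul_comm]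

theorem integrable_perturbation_mul (a d : ℝ) {g : Valuations → ℝ} (hg : Integrable g) :
    Integrable fun v => perturbation a d v * g v :=
  hg.bdd_mul (by fun_prop) (.of_forall (abs_perturbation_le_one a d))

/-- The density of the hard instance for which the best single price is `a + d`. -/
noncomputable def perturbedDensity (a d : ℝ) (v : Valuations) : ℝ :=
  baseDensity v + perturbation a d v

@[fun_prop]
theorem measurable_perturbedDensity (a d : ℝ) : Measurable (perturbedDensity a d) := by
  unfold perturbedDensity
  fun_prop

theorem perturbedDensity_le (a d : ℝ) (v : Valuations) : perturbedDensity a d v ≤ 9 := by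
  unfold perturbedDensity
  linarith [baseDensity_le v, (abs_le.1 (abs_perturbation_le_one a d v)).2]

/-- The hard instance for which the best single price is `a + d`. -/
noncomputable def perturbedLaw (a d : ℝ) : Measure Valuations := lawOf (perturbedDensity a d)

variable {a d : ℝ}

theorem perturbedDensity_nonneg (ha : 3 / 8 ≤ a) (hd : 0 ≤ d) (had : a + 2 * d ≤ 1 / 2)
    (v : Valuations) : 0 ≤ perturbedDensity a d v := by
  unfold perturbedDensity
  by_cases h₁ : (v.1 : ℝ) ∈ Set.Ioc a (a + 2 * d)
  · by_cases h₂ : (v.2 : ℝ) ∈ Set.Ioc (5 / 8 : ℝ) (5 / 8 + 2 * (1 / 16))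
    · rw [baseDensity_of_mem_band ⟨by linarith [h₁.2, h₂.1], by linarith [h₁.1, h₂.2]⟩]
      linarith [(abs_le.1 (abs_perturbation_le_one a d v)).1]
    · rw [perturbation, wave_of_notMem (by norm_num) h₂, mul_zero, neg_zero, add_zero]
      exact baseDensity_nonneg v
  · rw [perturbation, wave_of_notMem hd h₁, zero_mul, neg_zero, add_zero]
    exact baseDensity_nonneg v

theorem integral_perturbedDensity_mul (a d : ℝ) {g : Valuations → ℝ} (hg : Integrable g) :
    ∫ v, perturbedDensity a d v * g v =
      (∫ v, baseDensity v * g v) + ∫ v, perturbation a d v * g v := by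
  have hbase : Integrable fun v => baseDensity v * g v :=
    hg.bdd_mul (by fun_prop) (.of_forall fun v =>
      (Real.norm_of_nonneg (baseDensity_nonneg v)).trans_le (baseDensity_le v))
  rw [← integral_add hbase (integrable_perturbation_mul a d hg)]
  simp only [perturbedDensity, add_mul]

theorem integral_perturbedDensity (ha : 0 ≤ a) (hd : 0 ≤ d) (had : a + 2 * d ≤ 1) :
    ∫ v, perturbedDensity a d v = 1 := by
  have h₁ := integral_perturbedDensity_mul a d (g := fun _ => 1) (integrable_const _)
  have h₂ := integral_perturbation_mul a d (fun _ => 1) (fun _ => 1)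
  rw [integral_wave_mul_const ha hd had (c := 1) (fun _ _ => rfl), zero_mul, neg_zero] at h₂
  simp only [mul_one] at h₁ h₂
  rw [h₁, h₂, integral_baseDensity, add_zero]

theorem isProbabilityMeasure_perturbedLaw (ha : 3 / 8 ≤ a) (hd : 0 ≤ d)
    (had : a + 2 * d ≤ 1 / 2) : IsProbabilityMeasure (perturbedLaw a d) :=
  isProbabilityMeasure_lawOf (perturbedDensity_nonneg ha hd had)
    (integral_perturbedDensity (by linarith) hd (by linarith))

theorem integral_perturbedLaw (ha : 3 / 8 ≤ a) (hd : 0 ≤ d) (had : a + 2 * d ≤ 1 / 2)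
    {g : Valuations → ℝ} (hg : Integrable g) :
    ∫ v, g v ∂perturbedLaw a d = (∫ v, g v ∂baseLaw) + ∫ v, perturbation a d v * g v := by
  rw [perturbedLaw, integral_lawOf (by fun_prop) (perturbedDensity_nonneg ha hd had), baseLaw,
    integral_lawOf (by fun_prop) baseDensity_nonneg, integral_perturbedDensity_mul a d hg]

theorem perturbedLaw_real_prod (ha : 3 / 8 ≤ a) (hd : 0 ≤ d) (had : a + 2 * d ≤ 1 / 2)
    {S S' : Set unitInterval} (hS : MeasurableSet S) (hS' : MeasurableSet S') :
    (perturbedLaw a d).real (S ×ˢ S') = baseLaw.real (S ×ˢ S') -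
      (∫ s : unitInterval, wave a d s * S.indicator 1 s) *
        ∫ b : unitInterval, wave (5 / 8) (1 / 16) b * S'.indicator 1 b := by
  have hmeas := hS.prod hS'
  rw [← integral_indicator_one hmeas, ← integral_indicator_one hmeas,
    integral_perturbedLaw ha hd had (g := (S ×ˢ S').indicator 1)
      ((integrable_const (1 : ℝ)).indicator hmeas), sub_eq_add_neg, ← integral_perturbation_mul]
  simp only [← Set.indicator_prod_one]

end Perturbation

section Feedback

theorem measurableSet_setOf_le_iff (p : unitInterval) (z : Bool) :
    MeasurableSet {s : unitInterval | s ≤ p ↔ z = true} :=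
  (measurableSet_le measurable_id measurable_const).iff (.const _)

theorem measurableSet_setOf_ge_iff (p : unitInterval) (z : Bool) :
    MeasurableSet {s : unitInterval | p ≤ s ↔ z = true} :=
  (measurableSet_le measurable_const measurable_id).iff (.const _)

theorem preimage_twoBit (x : Prices) (z : Bool × Bool) :
    twoBit x ⁻¹' {z} = {s | s ≤ x.1.1 ↔ z.1 = true} ×ˢ {b | x.1.2 ≤ b ↔ z.2 = true} := by
  ext v
  rw [Set.mem_preimage, Set.mem_singleton_iff, twoBit, Prod.ext_iff]
  exact and_congr (Bool.eq_iff_iff.trans (by rw [decide_eq_true_iff]; rfl))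
    (Bool.eq_iff_iff.trans (by rw [decide_eq_true_iff]; rfl))

/-- The prices whose feedback may distinguish `perturbedLaw a d` from `baseLaw`. -/
def informative (a d : ℝ) : Set Prices :=
  {x | (x.1.1 : ℝ) ∈ Set.Ioc a (a + 2 * d) ∧
    (x.1.2 : ℝ) ∈ Set.Ioc (5 / 8) (5 / 8 + 2 * (1 / 16))}

/-- The prices that may be close to optimal for `perturbedLaw a d`. -/
def competitive (a d : ℝ) : Set Prices := {x | (x.1.1 : ℝ) ∈ Set.Ioc a (a + 2 * d)}

theorem measurableSet_competitive (a d : ℝ) : MeasurableSet (competitive a d) :=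
  measurable_subtype_coe.fst.subtype_val measurableSet_Ioc

theorem measurableSet_informative (a d : ℝ) : MeasurableSet (informative a d) :=
  (measurableSet_competitive a d).inter (measurable_subtype_coe.snd.subtype_val measurableSet_Ioc)

variable {a d : ℝ} {x : Prices}

theorem integral_wave_mul_indicator_le_iff (ha : 0 ≤ a) (hd : 0 ≤ d) (had : a + 2 * d ≤ 1)
    {p : unitInterval} (hp : (p : ℝ) ∉ Set.Ioc a (a + 2 * d)) (z : Bool) :
    ∫ s : unitInterval, wave a d s * {s | s ≤ p ↔ z = true}.indicator 1 s = 0 := by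
  classical
  refine integral_wave_mul_const ha hd had (c := if a + 2 * d < p ↔ z = true then 1 else 0)
    fun s hs => ?_
  have hsp : s ≤ p ↔ a + 2 * d < p :=
    ⟨fun h => not_le.1 fun h' => hp ⟨hs.1.trans_le h, h'⟩, fun h => (hs.2.trans_lt h).le⟩
  simp only [Set.indicator_apply, Set.mem_ofPred_eq, hsp, Pi.one_apply]

theorem integral_wave_mul_indicator_ge_iff (ha : 0 ≤ a) (hd : 0 ≤ d) (had : a + 2 * d ≤ 1)
    {p : unitInterval} (hp : (p : ℝ) ∉ Set.Ioc a (a + 2 * d)) (z : Bool) :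
    ∫ s : unitInterval, wave a d s * {s | p ≤ s ↔ z = true}.indicator 1 s = 0 := by
  classical
  refine integral_wave_mul_const ha hd had (c := if (p : ℝ) ≤ a ↔ z = true then 1 else 0)
    fun s hs => ?_
  have hsp : p ≤ s ↔ (p : ℝ) ≤ a :=
    ⟨fun h => not_lt.1 fun h' => hp ⟨h', le_trans (Subtype.coe_le_coe.2 h) hs.2⟩,
      fun h => (h.trans_lt hs.1).le⟩
  simp only [Set.indicator_apply, Set.mem_ofPred_eq, hsp, Pi.one_apply]

theorem perturbedLaw_real_preimage_twoBit_of_notMem (ha : 3 / 8 ≤ a) (hd : 0 ≤ d)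
    (had : a + 2 * d ≤ 1 / 2) (hx : x ∉ informative a d) (z : Bool × Bool) :
    (perturbedLaw a d).real (twoBit x ⁻¹' {z}) = baseLaw.real (twoBit x ⁻¹' {z}) := by
  rw [preimage_twoBit, perturbedLaw_real_prod ha hd had (measurableSet_setOf_le_iff _ _)
    (measurableSet_setOf_ge_iff _ _), sub_eq_self, mul_eq_zero]
  rcases not_and_or.1 hx with h | h
  · exact .inl (integral_wave_mul_indicator_le_iff (by linarith) hd (by linarith) h z.1)
  · exact .inr (integral_wave_mul_indicator_ge_iff (by norm_num) (by norm_num) (by norm_num) h z.2)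

theorem abs_baseLaw_real_sub_perturbedLaw_real_preimage_twoBit_le (ha : 3 / 8 ≤ a) (hd : 0 ≤ d)
    (had : a + 2 * d ≤ 1 / 2) (x : Prices) (z : Bool × Bool) :
    |baseLaw.real (twoBit x ⁻¹' {z}) - (perturbedLaw a d).real (twoBit x ⁻¹' {z})| ≤ d / 4 := by
  have hind (S : Set unitInterval) (s : unitInterval) :
      |S.indicator (1 : unitInterval → ℝ) s| ≤ 1 := by
    by_cases hs : s ∈ S <;> simp [hs]
  rw [preimage_twoBit, perturbedLaw_real_prod ha hd had (measurableSet_setOf_le_iff _ _)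
    (measurableSet_setOf_ge_iff _ _), sub_sub_cancel, abs_mul]
  calc _ ≤ 2 * d * (2 * (1 / 16)) :=
        mul_le_mul (abs_integral_wave_mul_le (by linarith) hd (by linarith) (hind _))
          (abs_integral_wave_mul_le (by norm_num) (by norm_num) (by norm_num) (hind _))
          (abs_nonneg _) (by linarith)
    _ = d / 4 := by ring

end Feedback

section Information

theorem feedbackKernel_real_singleton (μ : Measure Valuations) [IsProbabilityMeasure μ]
    (x : Prices) (z : Bool × Bool) : (feedbackKernel μ x).real {z} = μ.real (twoBit x ⁻¹' {z}) := by
  rw [feedbackKernel_apply, map_measureReal_apply (by fun_prop) (.singleton z)]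

theorem le_baseLaw_real_of_box_subset {u u' w w' : ℝ} (hu : 0 ≤ u) (huu : u ≤ u') (hu' : u' ≤ 1)
    (hw : 0 ≤ w) (hww : w ≤ w') (hw' : w' ≤ 1) (hsub : box u u' w w' ⊆ band ∪ corner)
    {S : Set Valuations} (hS : box u u' w w' ⊆ S) : (u' - u) * (w' - w) ≤ baseLaw.real S := by
  rw [← volumeReal_box hu huu hu' hw hww hw']
  exact (volumeReal_le_baseLaw_real (measurableSet_box _ _ _ _) hsub).trans (measureReal_mono hS)

theorem le_baseLaw_real_preimage_twoBit {x : Prices} (h₁ : (x.1.1 : ℝ) ∈ Set.Ico (3 / 8) (5 / 8))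
    (h₂ : (x.1.2 : ℝ) ∈ Set.Ioc (1 / 2) (3 / 4)) (z : Bool × Bool) :
    1 / 32 ≤ baseLaw.real (twoBit x ⁻¹' {z}) := by
  have hmem (v : Valuations) : v ∈ twoBit x ⁻¹' {z} ↔
      ((v.1 : ℝ) ≤ x.1.1 ↔ z.1 = true) ∧ ((x.1.2 : ℝ) ≤ v.2 ↔ z.2 = true) := by
    rw [preimage_twoBit]
    rfl
  rcases z with ⟨z₁ | z₁, z₂ | z₂⟩
  · calc (1 : ℝ) / 32 ≤ (1 - 3 / 4) * (1 / 4 - 0) := by norm_num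
      _ ≤ _ := le_baseLaw_real_of_box_subset (by norm_num) (by norm_num) (by norm_num)
        (by norm_num) (by norm_num) (by norm_num) (fun v hv => .inr (.inr hv)) fun v hv => by
          simp only [hmem, Bool.false_eq_true, iff_false, not_le]
          exact ⟨by linarith [hv.1.1, h₁.2], by linarith [hv.2.2, h₂.1]⟩
  · calc (1 : ℝ) / 32 = (3 / 4 - 5 / 8) * (1 - 3 / 4) := by norm_num
      _ ≤ _ := le_baseLaw_real_of_box_subset (by norm_num) (by norm_num) (by norm_num)
        (by norm_num) (by norm_num) (by norm_num)
        (fun v hv => .inl ⟨by linarith [hv.1.2, hv.2.1], by linarith [hv.1.1, hv.2.2]⟩)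
        fun v hv => by
          simp only [hmem, Bool.false_eq_true, iff_false, not_le, iff_true]
          exact ⟨by linarith [hv.1.1, h₁.2], by linarith [hv.2.1, h₂.2]⟩
  · calc (1 : ℝ) / 32 = (3 / 8 - 1 / 8) * (1 / 2 - 3 / 8) := by norm_num
      _ ≤ _ := le_baseLaw_real_of_box_subset (by norm_num) (by norm_num) (by norm_num)
        (by norm_num) (by norm_num) (by norm_num)
        (fun v hv => .inl ⟨by linarith [hv.1.2, hv.2.1], by linarith [hv.1.1, hv.2.2]⟩)
        fun v hv => by
          simp only [hmem, Bool.false_eq_true, iff_false, not_le, iff_true]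
          exact ⟨by linarith [hv.1.2, h₁.1], by linarith [hv.2.2, h₂.1]⟩
  · calc (1 : ℝ) / 32 ≤ (1 / 4 - 0) * (1 - 3 / 4) := by norm_num
      _ ≤ _ := le_baseLaw_real_of_box_subset (by norm_num) (by norm_num) (by norm_num)
        (by norm_num) (by norm_num) (by norm_num) (fun v hv => .inr (.inl hv)) fun v hv => by
          simp only [hmem, iff_true]
          exact ⟨by linarith [hv.1.2, h₁.1], by linarith [hv.2.1, h₂.2]⟩

variable {a d : ℝ}

theorem feedbackKernel_perturbedLaw_of_notMem (ha : 3 / 8 ≤ a) (hd : 0 ≤ d)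
    (had : a + 2 * d ≤ 1 / 2) {x : Prices} (hx : x ∉ informative a d) :
    feedbackKernel (perturbedLaw a d) x = feedbackKernel baseLaw x := by
  have := isProbabilityMeasure_perturbedLaw ha hd had
  refine Measure.ext_of_singleton fun z => (measureReal_eq_measureReal_iff).1 ?_
  rw [feedbackKernel_real_singleton, feedbackKernel_real_singleton,
    perturbedLaw_real_preimage_twoBit_of_notMem ha hd had hx]

theorem klDiv_feedbackKernel_le (ha : 3 / 8 ≤ a) (hd : 0 ≤ d) (had : a + 2 * d ≤ 1 / 2)
    (x : Prices) : klDiv (feedbackKernel baseLaw x) (feedbackKernel (perturbedLaw a d) x) ≤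
      (informative a d).indicator (fun _ => ENNReal.ofReal (16 * d ^ 2)) x := by
  have := isProbabilityMeasure_perturbedLaw ha hd had
  by_cases hx : x ∈ informative a d
  · rw [Set.indicator_of_mem hx]
    have hdiff (z : Bool × Bool) := abs_baseLaw_real_sub_perturbedLaw_real_preimage_twoBit_le
      ha hd had x z
    have hlow (z : Bool × Bool) : 1 / 64 ≤ (perturbedLaw a d).real (twoBit x ⁻¹' {z}) := by
      have := le_baseLaw_real_preimage_twoBit ⟨ha.trans hx.1.1.le, by linarith [hx.1.2]⟩
        ⟨by linarith [hx.2.1], by linarith [hx.2.2]⟩ z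
      linarith [(abs_le.1 (hdiff z)).2]
    refine (klDiv_le_sum_sq_div fun z => ?_).trans (ENNReal.ofReal_le_ofReal ?_)
    · rw [feedbackKernel_real_singleton]
      linarith [hlow z]
    · simp only [feedbackKernel_real_singleton]
      calc _ ≤ ∑ _ : Bool × Bool, (d / 4) ^ 2 / (1 / 64) := Finset.sum_le_sum fun z _ =>
            div_le_div₀ (sq_nonneg _) (sq_le_sq' (abs_le.1 (hdiff z)).1 (abs_le.1 (hdiff z)).2)
              (by norm_num) (hlow z)
        _ = 16 * d ^ 2 := by
          rw [Finset.sum_const, Finset.card_univ, Fintype.card_prod, Fintype.card_bool]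
          ring
  · rw [feedbackKernel_perturbedLaw_of_notMem ha hd had hx, klDiv_self]
    exact zero_le

theorem lintegral_klDiv_feedbackKernel_le (ha : 3 / 8 ≤ a) (hd : 0 ≤ d)
    (had : a + 2 * d ≤ 1 / 2) (ν : Measure Prices) [IsFiniteMeasure ν] :
    ∫⁻ x, klDiv (feedbackKernel baseLaw x) (feedbackKernel (perturbedLaw a d) x) ∂ν ≤
      ENNReal.ofReal (16 * d ^ 2 * ν.real (informative a d)) := by
  refine (lintegral_mono (klDiv_feedbackKernel_le ha hd had)).trans_eq ?_
  rw [lintegral_indicator_const (measurableSet_informative a d), ← ofReal_measureReal,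
    ← ENNReal.ofReal_mul (by positivity)]

theorem occupation_perturbedLaw_real_sub_le {Θ : Type*} [MeasurableSpace Θ] (A : Algorithm Θ)
    (ha : 3 / 8 ≤ a) (hd : 0 ≤ d) (had : a + 2 * d ≤ 1 / 2) (T : ℕ) {S : Set Prices}
    (hS : MeasurableSet S) :
    (A.occupation (perturbedLaw a d) T).real S - (A.occupation baseLaw T).real S ≤
      T * (1 / 4 + 32 * d ^ 2 * (A.occupation baseLaw T).real (informative a d)) := by
  have := isProbabilityMeasure_perturbedLaw ha hd had
  have hac (x : Prices) : feedbackKernel baseLaw x ≪ feedbackKernel (perturbedLaw a d) x := by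
    refine (klDiv_ne_top_iff.1 (ne_top_of_le_ne_top ?_ (klDiv_feedbackKernel_le ha hd had x))).1
    exact ((Set.indicator_le_self' fun _ _ => zero_le) x).trans_lt ENNReal.ofReal_lt_top |>.ne
  have hKL := lintegral_klDiv_feedbackKernel_le ha hd had (A.occupation baseLaw T)
  refine (A.occupation_real_sub_le hac (ne_top_of_le_ne_top ENNReal.ofReal_ne_top hKL) hS).trans ?_
  have hKL' := ENNReal.toReal_le_of_le_ofReal (by positivity) hKL
  gcongr
  -- AM-GM: `√y ≤ 1 / 4 + y`.
  refine Real.sqrt_le_iff.2 ⟨by positivity, ?_⟩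
  nlinarith [sq_nonneg (32 * d ^ 2 * (A.occupation baseLaw T).real (informative a d) - 1 / 4)]

end Information

section Gain

variable {a d : ℝ}

theorem integral_perturbation_mul_GFT_diag (a d : ℝ) (p : unitInterval) :
    ∫ v, perturbation a d v * GFT (diag p) v =
      (∫ s : unitInterval, wave a d s * (Set.Iic p).indicator (fun s => (s : ℝ)) s) *
        (∫ b : unitInterval, wave (5 / 8) (1 / 16) b * (Set.Ici p).indicator 1 b) -
      (∫ s : unitInterval, wave a d s * (Set.Iic p).indicator 1 s) *
        ∫ b : unitInterval,
          wave (5 / 8) (1 / 16) b * (Set.Ici p).indicator (fun b => (b : ℝ)) b := by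
  have hone : Integrable (1 : unitInterval → ℝ) := integrable_const 1
  have hid : Integrable fun s : unitInterval => (s : ℝ) :=
    .of_bound (by fun_prop : Measurable _).aestronglyMeasurable 1
      (.of_forall fun s => (Real.norm_of_nonneg s.2.1).trans_le s.2.2)
  have hGFT (v : Valuations) : GFT (diag p) v =
      (Set.Iic p).indicator 1 v.1 * (Set.Ici p).indicator (fun b => (b : ℝ)) v.2 -
        (Set.Iic p).indicator (fun s => (s : ℝ)) v.1 * (Set.Ici p).indicator 1 v.2 := by
    rw [GFT_diag]
    by_cases h₁ : v.1 ≤ p <;> by_cases h₂ : p ≤ v.2 <;> simp [h₁, h₂]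
  simp only [hGFT, mul_sub]
  rw [integral_sub (integrable_perturbation_mul a d
      ((hone.indicator measurableSet_Iic).mul_prod (hid.indicator measurableSet_Ici)))
    (integrable_perturbation_mul a d
      ((hid.indicator measurableSet_Iic).mul_prod (hone.indicator measurableSet_Ici))),
    integral_perturbation_mul, integral_perturbation_mul]
  ring

theorem integral_perturbation_mul_GFT_diag_of_le (a d : ℝ) {p : unitInterval}
    (hp : (p : ℝ) ≤ 5 / 8) :
    ∫ v, perturbation a d v * GFT (diag p) v =
      (∫ s : unitInterval, wave a d s * (Set.Iic p).indicator 1 s) / 256 := by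
  have hmem (b : unitInterval) (hb : (b : ℝ) ∈ Set.Ioc (5 / 8) (5 / 8 + 2 * (1 / 16))) :
      b ∈ Set.Ici p := Subtype.coe_le_coe.1 (hp.trans hb.1.le)
  rw [integral_perturbation_mul_GFT_diag,
    integral_wave_mul_const (a := 5 / 8) (d := 1 / 16) (f := (Set.Ici p).indicator 1) (c := 1)
      (by norm_num) (by norm_num) (by norm_num) fun b hb => Set.indicator_of_mem (hmem b hb) _,
    integral_wave_mul_id (a := 5 / 8) (d := 1 / 16) (by norm_num) (by norm_num) (by norm_num)
      fun b hb => Set.indicator_of_mem (hmem b hb) _]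
  ring

theorem integral_wave_mul_indicator_Iic_midpoint (ha : 0 ≤ a) (hd : 0 ≤ d) (had : a + d ≤ 1)
    {m : unitInterval} (hm : (m : ℝ) = a + d) :
    ∫ s : unitInterval, wave a d s * (Set.Iic m).indicator 1 s = d := by
  have hwave (s : unitInterval) : wave a d s * (Set.Iic m).indicator 1 s =
      (Set.Ioc a (a + d)).indicator (fun _ => 1) (s : ℝ) := by
    by_cases hs : s ≤ m
    · have hs' : (s : ℝ) ≤ a + d := hm ▸ hs
      simp [wave, hs, hs', not_lt.2 hs', Set.indicator_apply]
    · have hs' : ¬(s : ℝ) ≤ a + d := hm ▸ hs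
      simp [hs, hs']
  simp only [hwave]
  rw [integral_indicator_Ioc ha (by linarith) had]
  simp

theorem integral_perturbation_mul_GFT_diag_le (ha : 0 ≤ a) (hd : 0 ≤ d) (had : a + 2 * d ≤ 5 / 8)
    {p : unitInterval} (hp : (p : ℝ) ∈ Set.Ioc a (a + 2 * d)) :
    ∫ v, perturbation a d v * GFT (diag p) v ≤ d / 256 := by
  rw [integral_perturbation_mul_GFT_diag_of_le a d (hp.2.trans had)]
  gcongr
  exact integral_wave_mul_le ha hd (by linarith) (measurable_one.indicator measurableSet_Iic)
    (Set.indicator_nonneg fun _ _ => zero_le_one) (Set.indicator_le_self' fun _ _ => zero_le_one)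

theorem integral_perturbation_mul_GFT_diag_le_of_notMem (ha : 0 ≤ a) (hd : 0 ≤ d)
    (had : a + 2 * d ≤ 1) {p : unitInterval} (hp : (p : ℝ) ∉ Set.Ioc a (a + 2 * d)) :
    ∫ v, perturbation a d v * GFT (diag p) v ≤ d ^ 2 / 8 := by
  rw [integral_perturbation_mul_GFT_diag]
  rcases not_and_or.1 hp with hp | hp
  · have hmem (s : unitInterval) (hs : (s : ℝ) ∈ Set.Ioc a (a + 2 * d)) : s ∉ Set.Iic p :=
      fun h => hp (hs.1.trans_le h)
    rw [integral_wave_mul_const ha hd had fun s hs => Set.indicator_of_notMem (hmem s hs) _,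
      integral_wave_mul_const ha hd had fun s hs => Set.indicator_of_notMem (hmem s hs) _,
      zero_mul, zero_mul, sub_zero]
    positivity
  · have hmem (s : unitInterval) (hs : (s : ℝ) ∈ Set.Ioc a (a + 2 * d)) : s ∈ Set.Iic p :=
      Subtype.coe_le_coe.1 (hs.2.trans (not_le.1 hp).le)
    have hB := abs_integral_wave_mul_le (a := 5 / 8) (d := 1 / 16)
      (f := (Set.Ici p).indicator 1) (by norm_num) (by norm_num) (by norm_num)
      fun b => by by_cases hb : b ∈ Set.Ici p <;> simp [hb]
    rw [integral_wave_mul_id ha hd had fun s hs => Set.indicator_of_mem (hmem s hs) _,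
      integral_wave_mul_const (f := (Set.Iic p).indicator 1) (c := 1) ha hd had
        fun s hs => Set.indicator_of_mem (hmem s hs) _]
    nlinarith [(abs_le.1 hB).1, sq_nonneg d]

theorem expectedGFT_perturbedLaw (ha : 3 / 8 ≤ a) (hd : 0 ≤ d) (had : a + 2 * d ≤ 1 / 2)
    (x : Prices) : expectedGFT (perturbedLaw a d) x =
      expectedGFT baseLaw x + ∫ v, perturbation a d v * GFT x v :=
  integral_perturbedLaw ha hd had (integrable_GFT _ x)

theorem expectedGFT_perturbedLaw_midpoint (ha : 3 / 8 ≤ a) (hd : 0 ≤ d) (had : a + 2 * d ≤ 1 / 2)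
    {m : unitInterval} (hm : (m : ℝ) = a + d) :
    expectedGFT (perturbedLaw a d) (diag m) = expectedGFT baseLaw (diag m) + d / 256 := by
  rw [expectedGFT_perturbedLaw ha hd had, integral_perturbation_mul_GFT_diag_of_le a d
    (by linarith), integral_wave_mul_indicator_Iic_midpoint (by linarith) hd (by linarith) hm]

theorem expectedGFT_perturbedLaw_add_le (ha : 3 / 8 ≤ a) (hd : 0 ≤ d) (had : a + 2 * d ≤ 1 / 2)
    (hd' : d ≤ 1 / 64) {m : unitInterval} (hm : (m : ℝ) = a + d) {x : Prices}
    (hx : x ∉ competitive a d) :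
    expectedGFT (perturbedLaw a d) x + d / 512 ≤ expectedGFT (perturbedLaw a d) (diag m) := by
  have := isProbabilityMeasure_perturbedLaw ha hd had
  have hdiag := expectedGFT_le_diag (perturbedLaw a d) x
  have hpert := integral_perturbation_mul_GFT_diag_le_of_notMem (by linarith) hd (by linarith) hx
  rw [expectedGFT_perturbedLaw ha hd had (diag _)] at hdiag
  rw [expectedGFT_perturbedLaw_midpoint ha hd had hm]
  nlinarith [expectedGFT_baseLaw_le ⟨by linarith, by linarith⟩ (diag x.1.1) (q := m)]

theorem expectedGFT_perturbedLaw_le (ha : 3 / 8 ≤ a) (hd : 0 ≤ d) (had : a + 2 * d ≤ 1 / 2)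
    (hd' : d ≤ 1 / 64) {m : unitInterval} (hm : (m : ℝ) = a + d) (x : Prices) :
    expectedGFT (perturbedLaw a d) x ≤ expectedGFT (perturbedLaw a d) (diag m) := by
  by_cases hx : x ∈ competitive a d
  · have := isProbabilityMeasure_perturbedLaw ha hd had
    have hdiag := expectedGFT_le_diag (perturbedLaw a d) x
    have hpert := integral_perturbation_mul_GFT_diag_le (by linarith) hd (by linarith) hx
    rw [expectedGFT_perturbedLaw ha hd had (diag _)] at hdiag
    rw [expectedGFT_perturbedLaw_midpoint ha hd had hm]
    linarith [expectedGFT_baseLaw_le ⟨by linarith, by linarith⟩ (diag x.1.1) (q := m)]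
  · linarith [expectedGFT_perturbedLaw_add_le ha hd had hd' hm hx]

theorem expectedGFT_baseLaw_add_le {x : Prices} (h₁ : (x.1.1 : ℝ) ∈ Set.Icc (3 / 8) (1 / 2))
    (h₂ : (x.1.2 : ℝ) ∈ Set.Icc (5 / 8) (3 / 4)) :
    expectedGFT baseLaw x + 1 / 128 ≤ expectedGFT baseLaw (diag x.1.1) := by
  set S := box 0 (1 / 4) (3 / 4) 1
  have hS : MeasurableSet S := measurableSet_box _ _ _ _
  have hmass : 1 / 16 ≤ baseLaw.real S :=
    le_trans (by norm_num) (le_baseLaw_real_of_box_subset (by norm_num) (by norm_num) (by norm_num)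
      (by norm_num) (by norm_num) (by norm_num) (fun v hv => .inr (.inl hv)) subset_rfl)
  have hloss (v : Valuations) : S.indicator (fun _ => 1 / 8) v ≤ GFT (diag x.1.1) v - GFT x v := by
    by_cases hv : v ∈ S
    · have hs : v.1 ≤ x.1.1 := Subtype.coe_le_coe.1 (by linarith [hv.1.2, h₁.1])
      have hb : x.1.2 ≤ v.2 := Subtype.coe_le_coe.1 (by linarith [hv.2.1, h₂.2])
      rw [Set.indicator_of_mem hv, GFT_diag, if_pos ⟨hs, le_trans x.2 hb⟩, GFT,
        if_pos ⟨hs, x.2, hb⟩]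
      linarith [h₁.2, h₂.1]
    · rw [Set.indicator_of_notMem hv, sub_nonneg]
      exact GFT_le_GFT_diag x v
  have hint : ∫ v, S.indicator (fun _ => (1 / 8 : ℝ)) v ∂baseLaw ≤
      ∫ v, (GFT (diag x.1.1) v - GFT x v) ∂baseLaw :=
    integral_mono ((integrable_const _).indicator hS)
      ((integrable_GFT _ _).sub (integrable_GFT _ _)) hloss
  rw [integral_indicator_const _ hS, smul_eq_mul, ← expectedGFT_sub] at hint
  linarith

end Gain

section Strips

variable {d : ℝ} {k K : ℕ}

/-- The left endpoint of the `k`-th of the strips of width `2 * d` to the right of `3 / 8`. -/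
noncomputable def stripStart (d : ℝ) (k : ℕ) : ℝ := 3 / 8 + 2 * d * k

theorem stripStart_succ (d : ℝ) (k : ℕ) : stripStart d (k + 1) = stripStart d k + 2 * d := by
  simp only [stripStart, Nat.cast_succ]
  ring

theorem monotone_stripStart (hd : 0 ≤ d) : Monotone (stripStart d) :=
  monotone_nat_of_le_succ fun k => by linarith [stripStart_succ d k]

theorem le_stripStart (hd : 0 ≤ d) (k : ℕ) : 3 / 8 ≤ stripStart d k :=
  le_add_of_nonneg_right (by positivity)

theorem stripStart_add_le (hd : 0 ≤ d) (hK : stripStart d K ≤ 1 / 2) (hk : k < K) :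
    stripStart d k + 2 * d ≤ 1 / 2 :=
  (stripStart_succ d k).symm.trans_le ((monotone_stripStart hd hk).trans hK)

theorem pairwise_disjoint_competitive (hd : 0 ≤ d) :
    Pairwise (Function.onFun Disjoint fun k => competitive (stripStart d k) d) := fun j k hjk => by
  have h := (monotone_stripStart hd).pairwise_disjoint_on_Ioc_succ hjk
  simp only [Function.onFun, Nat.succ_eq_succ, Nat.succ_eq_add_one, stripStart_succ] at h
  exact h.preimage fun x : Prices => (x.1.1 : ℝ)

end Strips

section LowerBound

variable {σ d : ℝ} {K : ℕ} {Θ : Type*} [MeasurableSpace Θ] (A : Algorithm Θ)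

theorem sum_informative_le_regret_baseLaw (hd : 0 ≤ d) (hK : stripStart d K ≤ 1 / 2)
    (hs : IsSmooth σ baseLaw) (T : ℕ) :
    1 / 128 * ∑ k ∈ Finset.range K,
        (A.occupation baseLaw T).real (informative (stripStart d k) d) ≤
      regret A (Adversary.iid baseLaw inferInstance hs) T := by
  have hdisj : Pairwise (Function.onFun Disjoint fun k => informative (stripStart d k) d) :=
    (pairwise_disjoint_competitive hd).mono fun j k h =>
      h.mono (fun _ hx => hx.1) (fun _ hx => hx.1)
  have hbest := expectedGFT_baseLaw_le (q := ⟨1 / 2, by norm_num, by norm_num⟩)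
    ⟨by norm_num, by norm_num⟩
  rw [← measureReal_biUnion_finset (hdisj.set_pairwise _) fun k _ =>
    measurableSet_informative (stripStart d k) d]
  refine mul_occupation_real_le_regret baseLaw A hs T hbest (by norm_num) fun x hx => ?_
  obtain ⟨k, hk, hx₁, hx₂⟩ : ∃ k < K, x ∈ informative (stripStart d k) d := by simpa using hx
  have h₁ : (x.1.1 : ℝ) ∈ Set.Icc (3 / 8) (1 / 2) :=
    ⟨(le_stripStart hd k).trans hx₁.1.le, hx₁.2.trans (stripStart_add_le hd hK hk)⟩
  have h₂ : (x.1.2 : ℝ) ∈ Set.Icc (5 / 8) (3 / 4) := ⟨hx₂.1.le, hx₂.2.trans (by norm_num)⟩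
  exact (expectedGFT_baseLaw_add_le h₁ h₂).trans (hbest _)

theorem competitive_deficit_le_regret_perturbedLaw {a : ℝ} (ha : 3 / 8 ≤ a) (hd : 0 ≤ d)
    (had : a + 2 * d ≤ 1 / 2) (hd' : d ≤ 1 / 64) (hμ : IsProbabilityMeasure (perturbedLaw a d))
    (hs : IsSmooth σ (perturbedLaw a d)) (T : ℕ) :
    d / 512 * (T - (A.occupation (perturbedLaw a d) T).real (competitive a d)) ≤
      regret A (Adversary.iid (perturbedLaw a d) hμ hs) T := by
  have hm : a + d ∈ unitInterval := ⟨by linarith, by linarith⟩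
  rw [← A.occupation_real_univ (perturbedLaw a d) T,
    ← measureReal_compl (measurableSet_competitive a d)]
  exact mul_occupation_real_le_regret _ A hs T
    (expectedGFT_perturbedLaw_le (m := ⟨a + d, hm⟩) ha hd had hd' rfl) (by positivity)
    fun x hx => expectedGFT_perturbedLaw_add_le ha hd had hd' rfl hx

theorem exists_le_regret_perturbedLaw (hd : 0 ≤ d) (hd' : d ≤ 1 / 64)
    (hK : stripStart d K ≤ 1 / 2) (hK₀ : 0 < K) (T : ℕ) {r : ℝ}
    (hr : K * r ≤ d / 512 * (T * (3 / 4 * K - 1 - 32 * d ^ 2 * ∑ k ∈ Finset.range K,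
      (A.occupation baseLaw T).real (informative (stripStart d k) d)))) :
    ∃ k < K, ∀ (hμ : IsProbabilityMeasure (perturbedLaw (stripStart d k) d))
      (hs : IsSmooth σ (perturbedLaw (stripStart d k) d)),
      r ≤ regret A (Adversary.iid (perturbedLaw (stripStart d k) d) hμ hs) T := by
  let comp (k : ℕ) : ℝ := (A.occupation baseLaw T).real (competitive (stripStart d k) d)
  let info (k : ℕ) : ℝ := (A.occupation baseLaw T).real (informative (stripStart d k) d)
  have hcomp : ∑ k ∈ Finset.range K, comp k ≤ T :=
    (sum_measureReal_le_measureReal_univ (fun _ _ => measurableSet_competitive _ d)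
      ((pairwise_disjoint_competitive hd).set_pairwise _)).trans_eq
      (A.occupation_real_univ baseLaw T)
  have hsum : ∑ _k ∈ Finset.range K, r ≤
      ∑ k ∈ Finset.range K, d / 512 * (T * (3 / 4 - 32 * d ^ 2 * info k) - comp k) := by
    simp only [← Finset.mul_sum, Finset.sum_sub_distrib, Finset.sum_const, Finset.card_range,
      nsmul_eq_mul]
    refine hr.trans (mul_le_mul_of_nonneg_left ?_ (by positivity))
    linarith
  obtain ⟨k, hk, hrk⟩ := Finset.exists_le_of_sum_le (Finset.nonempty_range_iff.2 hK₀.ne') hsum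
  refine ⟨k, Finset.mem_range.1 hk, fun hμ hs => hrk.trans ?_⟩
  have ha := le_stripStart hd k
  have had := stripStart_add_le hd hK (Finset.mem_range.1 hk)
  have hchange := occupation_perturbedLaw_real_sub_le A ha hd had T
    (measurableSet_competitive (stripStart d k) d)
  refine le_trans (mul_le_mul_of_nonneg_left ?_ (by positivity))
    (competitive_deficit_le_regret_perturbedLaw A ha hd had hd' hμ hs T)
  linarith

theorem exists_iid_pow_three_le_regret (hσ₀ : 0 < σ) (hσ : σ ≤ 1 / 9) {T : ℕ} {n : ℝ}
    (hn : 0 ≤ n) (hnT : (T : ℝ) = n ^ 4) (hK : 4 ≤ K) (hnK : n ≤ K) (hKn : K * n ^ 3 ≤ 6 * n ^ 4) :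
    ∃ (μ : Measure Valuations) (hμ : IsProbabilityMeasure μ) (hs : IsSmooth σ μ),
      1 / 50 ^ 3 * n ^ 3 ≤ regret A (Adversary.iid μ hμ hs) T := by
  have hσ' : 9 ≤ σ⁻¹ := by simpa using inv_anti₀ hσ₀ hσ
  have hK' : (4 : ℝ) ≤ K := by exact_mod_cast hK
  obtain ⟨d, hd, hdK⟩ : ∃ d : ℝ, 0 ≤ d ∧ d * K = 1 / 16 := ⟨1 / (16 * K), by positivity, by field⟩
  have hd' : d ≤ 1 / 64 := by nlinarith
  have hstrip : stripStart d K ≤ 1 / 2 := by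
    rw [stripStart]
    linarith
  set N := ∑ k ∈ Finset.range K, (A.occupation baseLaw T).real (informative (stripStart d k) d)
  rcases le_total N (K ^ 3 / 16) with hN' | hN'
  · have hinfo : 32 * d ^ 2 * N ≤ K / 128 :=
      calc 32 * d ^ 2 * N ≤ 32 * d ^ 2 * (K ^ 3 / 16) := by gcongr
        _ = 2 * (d * K) ^ 2 * K := by ring
        _ = K / 128 := by rw [hdK]; ring
    have hgain : K * (1 / 50 ^ 3 * n ^ 3) ≤
        d / 512 * (T * (3 / 4 * K - 1 - 32 * d ^ 2 * N)) :=
      calc K * (1 / 50 ^ 3 * n ^ 3) ≤ d * K * n ^ 4 * (63 / 65536) := by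
            rw [hdK]
            linarith [pow_nonneg hn 4]
        _ = d / 512 * (T * (63 / 128 * K)) := by rw [hnT]; ring
        _ ≤ d / 512 * (T * (3 / 4 * K - 1 - 32 * d ^ 2 * N)) := by gcongr; linarith
    obtain ⟨k, hk, hreg⟩ := exists_le_regret_perturbedLaw A hd hd' hstrip (by omega) T hgain
    exact ⟨_, isProbabilityMeasure_perturbedLaw (le_stripStart hd k) hd
      (stripStart_add_le hd hstrip hk),
      isSmooth_lawOf hσ₀ fun v => (perturbedDensity_le _ _ v).trans hσ', hreg _ _⟩
  · have hs : IsSmooth σ baseLaw :=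
      isSmooth_lawOf hσ₀ fun v => (baseDensity_le v).trans (le_trans (by norm_num) hσ')
    refine ⟨_, inferInstance, hs, ?_⟩
    have hn3 : n ^ 3 ≤ K ^ 3 := by gcongr
    linarith [pow_nonneg hn 3, sum_informative_le_regret_baseLaw A hd hstrip hs T]

end LowerBound

end BilateralTrade

theorem theorem3_general (σ : ℝ) (hσ₀ : 0 < σ) (hσ : σ ≤ 1 / 9) (T : ℕ)
    {Θ : Type*} [MeasurableSpace Θ] (A : BilateralTrade.Algorithm Θ) :
    (((1 / 50 ^ 3 : ℝ) * (T : ℝ) ^ (3 / 4 : ℝ) : ℝ) : EReal)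
        ≤ BilateralTrade.worstCaseRegret A σ T ∧
    ∃ (μ : MeasureTheory.Measure BilateralTrade.Valuations)
      (hμ : MeasureTheory.IsProbabilityMeasure μ) (hs : BilateralTrade.IsSmooth σ μ),
      (1 / 50 ^ 3 : ℝ) * (T : ℝ) ^ (3 / 4 : ℝ)
        ≤ BilateralTrade.regret A (BilateralTrade.Adversary.iid (σ := σ) μ hμ hs) T := by
  set n : ℝ := (T : ℝ) ^ (1 / 4 : ℝ)
  have hpow (j : ℕ) : n ^ j = (T : ℝ) ^ (j / 4 : ℝ) := by
    rw [← Real.rpow_mul_natCast T.cast_nonneg, one_div_mul_eq_div]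
  have hn : 0 ≤ n := by positivity
  have hnT : (T : ℝ) = n ^ 4 := by rw [hpow]; norm_num
  have hK : (⌈n⌉₊ + 4 : ℕ) * n ^ 3 ≤ 6 * n ^ 4 := by
    rcases T.eq_zero_or_pos with rfl | hT
    · simp [n]
    · have hn₁ : 1 ≤ n := Real.one_le_rpow (by exact_mod_cast hT) (by norm_num)
      push_cast
      nlinarith [pow_nonneg hn 3, Nat.ceil_lt_add_one hn]
  obtain ⟨μ, hμ, hs, h⟩ := BilateralTrade.exists_iid_pow_three_le_regret A hσ₀ hσ hn hnT
    (K := ⌈n⌉₊ + 4) (by omega) ((Nat.le_ceil n).trans (by norm_num)) hK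
  rw [hpow, Nat.cast_ofNat] at h
  exact ⟨(EReal.coe_le_coe_iff.2 h).trans (le_iSup (fun S : BilateralTrade.Adversary Θ σ =>
    (BilateralTrade.regret A S T : EReal)) _), μ, hμ, hs, h⟩

theorem theorem3 (σ : ℝ) (hσ₀ : 0 < σ) (hσ : σ ≤ 1 / 9) (T : ℕ) (hT : 8008 ≤ T)
    {Θ : Type*} [MeasurableSpace Θ] (A : BilateralTrade.Algorithm Θ) :
    (((1 / 50 ^ 3 : ℝ) * (T : ℝ) ^ (3 / 4 : ℝ) : ℝ) : EReal)
        ≤ BilateralTrade.worstCaseRegret A σ T ∧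
    ∃ (μ : MeasureTheory.Measure BilateralTrade.Valuations)
      (hμ : MeasureTheory.IsProbabilityMeasure μ) (hs : BilateralTrade.IsSmooth σ μ),
      (1 / 50 ^ 3 : ℝ) * (T : ℝ) ^ (3 / 4 : ℝ)
        ≤ BilateralTrade.regret A (BilateralTrade.Adversary.iid (σ := σ) μ hμ hs) T :=
  theorem3_general σ hσ₀ hσ T A
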